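/- Let $\alpha\in\mathbb{R}$ with $|\alpha|>1$ be fixed, and let $f\colon\mathbb{R}\to\mathbb{C}$ be a $1$-periodic function in $L^1_{\mathrm{loc}}(\mathbb{R})$. Assume that there is a finite set $F\subset[0,1]$ such that, for every $\delta>0$, $f$ is Riemann-integrable on $[0,1]\setminus\bigl(F+(-\delta,\delta)\bigr)$. Assume further that, for every $z\in F$, there is a $\delta_z>0$ such that $f$ is differentiable on $(z-\delta_z,z+\delta_z)\setminus\{z\}$ and such that, for every $s>0$, there is an $\eta=\eta(z,s)>0$ with $$V_N(z,s):=\int_{z-\delta_z}^{z-N^{-s}}|f'(x)|\,\mathrm{d}x+\int_{z+N^{-s}}^{z+\delta_z}|f'(x)|\,\mathrm{d}x \,=\, o\bigl(N^{\frac{s}{2}-\eta}\bigr)\qquad\text{as } N\to\infty,$$ where, for all large $N$, this includes the integrability of $|f'|$ over the intervals involved. Then, for Lebesgue-almost every $x\in\mathbb{R}$, $$\frac1N\sum_{n=0}^{N-1}f(\alpha^n x)\;\xrightarrow{\,N\to\infty\,}\;\int_0^1 f(y)\,\mathrm{d}y ,$$ and this limit equals the mean $M(f)=\lim_{T\to\infty}\frac{1}{2T}\int_{-T}^{T}f(y)\,\mathrm{d}y$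 of $f$ (in particular, the latter limit exists). -/

import Mathlib

open Set Filter Topology MeasureTheory
open scoped Pointwise ENNReal

namespace SobolAverage

/-- The interval from `a` to `b`, as a one-dimensional box. -/
def intervalBox (a b : ℝ) (h : a < b) : BoxIntegral.Box (Fin 1) :=
  ⟨fun _ => a, fun _ => b, fun _ => h⟩

/-- `f` is Riemann-integrable on the compact interval `[a, b]`: its Riemann sums over tagged
partitions converge as the mesh tends to `0` (no condition if `b ≤ a`). -/
def RiemannIntegrableIcc (f : ℝ → ℂ) (a b : ℝ) : Prop :=
  ∀ h : a < b,
    BoxIntegral.Integrable (intervalBox a b h) BoxIntegral.IntegrationParams.Riemann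
      (fun x : Fin 1 → ℝ => f (x 0))
      ((volume : Measure (Fin 1 → ℝ)).toBoxAdditive.toSMul (E := ℂ))

/-- `f` is Riemann-integrable on the subset `A` of `[a, b]`: the extension of `f|_A` by zero is
Riemann-integrable on `[a, b]`. Here, `A` will be a finite union of compact intervals. -/
def RiemannIntegrableOn (f : ℝ → ℂ) (A : Set ℝ) (a b : ℝ) : Prop :=
  RiemannIntegrableIcc (A.indicator f) a b

/-- The variation `V_N(z,s)`, the integral of `|f'|` over
`(z - δ, z - N⁻ˢ) ∪ (z + N⁻ˢ, z + δ)`, with value `∞` if `|f'|` is not integrable there. -/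
noncomputable def V (f : ℝ → ℂ) (z δ s : ℝ) (N : ℕ) : ℝ≥0∞ :=
  (∫⁻ x in Ioo (z - δ) (z - 1 / (N : ℝ) ^ s), ‖deriv f x‖ₑ) +
    ∫⁻ x in Ioo (z + 1 / (N : ℝ) ^ s) (z + δ), ‖deriv f x‖ₑ

/-- The mean `M(f) = lim_{T → ∞} (2T)⁻¹ ∫_{-T}^{T} f(y) dy` exists and equals `m`. -/
def HasMean (f : ℝ → ℂ) (m : ℂ) : Prop :=
  Tendsto (fun T : ℝ => (1 / (2 * T : ℂ)) * ∫ y in (-T)..T, f y) atTop (𝓝 m)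

end SobolAverage

namespace SobolAverage

/-! ### Riemann integrability and oscillation -/

/-! The engine is an L² estimate for centred indicators ψ of arcs. Since α need not be an integer,
ψ(αᵐx) and ψ(αⁿx) are not orthogonal, but their correlation over a fixed interval is O(|α|^{-|n-m|})
(`abs_integral_centeredArc_mul_le`): on each interval where the slow indicator is 1, the integral of
the fast one nearly cancels. Hence the partial sums have second moment O(N), with a constant
independent of the arc (`integral_arcSum_sq_le`). Along N = j² this is summable after division by
N², and monotonicity fills the gaps, so almost every orbit has the right frequency in every rational
arc (`ae_tendsto_arc_average`).

Away from F, Riemann integrability replaces f by step functions. Near z in F, the variation bound at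
s = 1 gives ‖f‖ ≤ C qᵏ on the shell at distance about 2⁻ᵏ, with q² < 2
(`exists_growth_of_variation`). Choose r > q with r² < 2. Uniformity of the L² constant gives, at
the times 2^{Mj}, visit frequencies at most 2·2⁻ᵏ + r⁻ᵏ for all k ≤ (M+1)j at once, while a
first-moment bound excludes visits closer than 2^{-(M+1)j} (`ae_eventually_dyadic`). The
contribution near z is then a tail of the geometric series in q/r (`ae_exists_radius`).
`tendsto_average_of_orbit` combines these facts for a single orbit. -/

theorem mem_intervalBox {a b : ℝ} (h : a < b) (x : Fin 1 → ℝ) :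
    x ∈ intervalBox a b h ↔ x 0 ∈ Ioc a b := by
  simp [BoxIntegral.Box.mem_def, intervalBox, Fin.forall_fin_one]

theorem mem_Icc_intervalBox {a b : ℝ} (h : a < b) (x : Fin 1 → ℝ) :
    x ∈ BoxIntegral.Box.Icc (intervalBox a b h) ↔ x 0 ∈ Icc a b := by
  simp [BoxIntegral.Box.Icc_def, intervalBox, Pi.le_def, Fin.forall_fin_one]

theorem measureReal_intervalBox {a b : ℝ} (h : a < b) :
    volume.real (intervalBox a b h : Set (Fin 1 → ℝ)) = b - a := by
  rw [measureReal_def, BoxIntegral.Box.coe_eq_pi, Real.volume_pi_Ioc_toReal]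
  · simp [intervalBox]
  · intro i
    exact h.le

theorem div_lt_succ_div {n : ℕ} (hn : 0 < n) (i : ℕ) : (i : ℝ) / n < ((i : ℝ) + 1) / n := by
  have : (0 : ℝ) < n := by exact_mod_cast hn
  gcongr
  linarith

/-- The `i`-th cell of the subdivision of the line into intervals of length `1 / n`. -/
noncomputable def cellBox (n : ℕ) (hn : 0 < n) (i : ℕ) : BoxIntegral.Box (Fin 1) :=
  intervalBox ((i : ℝ) / n) (((i : ℝ) + 1) / n) (div_lt_succ_div hn i)

theorem cellBox_index {n : ℕ} (hn : 0 < n) (i : ℕ) :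
    ⌊(n : ℝ) * (cellBox n hn i).lower 0⌋₊ = i := by
  have : (n : ℝ) ≠ 0 := by exact_mod_cast hn.ne'
  have h : (n : ℝ) * ((i : ℝ) / n) = i := by field_simp
  simp [cellBox, intervalBox, h]

theorem cellBox_injective {n : ℕ} (hn : 0 < n) : Function.Injective (cellBox n hn) := by
  intro i j h
  rw [← cellBox_index hn i, h, cellBox_index]

theorem mem_cellBox {n : ℕ} (hn : 0 < n) (i : ℕ) (x : Fin 1 → ℝ) :
    x ∈ cellBox n hn i ↔ (i : ℝ) < n * x 0 ∧ n * x 0 ≤ i + 1 := by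
  have : (0 : ℝ) < n := by exact_mod_cast hn
  rw [cellBox, mem_intervalBox, mem_Ioc, div_lt_iff₀' this, le_div_iff₀' this]

/-- The uniform tagged partition of `[0, 1]` into `n` cells, with the tag `t i` in the `i`-th
cell. -/
noncomputable def uniformPartition (n : ℕ) (hn : 0 < n) (t : ℕ → ℝ)
    (ht : ∀ i, t i ∈ Icc (0 : ℝ) 1) :
    BoxIntegral.TaggedPrepartition (intervalBox 0 1 zero_lt_one) where
  boxes := (Finset.range n).map ⟨cellBox n hn, cellBox_injective hn⟩
  le_of_mem' := by
    intro J hJ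
    simp only [Finset.mem_map, Finset.mem_range, Function.Embedding.coeFn_mk] at hJ
    obtain ⟨i, hi, rfl⟩ := hJ
    intro x hx
    rw [mem_cellBox] at hx
    rw [mem_intervalBox, mem_Ioc]
    have h0 : (0 : ℝ) < n := by exact_mod_cast hn
    have h1 : (i : ℝ) + 1 ≤ n := by exact_mod_cast hi
    have h2 : (0 : ℝ) ≤ i := by positivity
    constructor <;> nlinarith
  pairwiseDisjoint := by
    intro J hJ J' hJ' hne
    simp only [Finset.coe_map, Function.Embedding.coeFn_mk, mem_image, Finset.mem_coe] at hJ hJ'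
    obtain ⟨i, hi, rfl⟩ := hJ
    obtain ⟨j, hj, rfl⟩ := hJ'
    refine Set.disjoint_left.2 fun x hx hx' => hne ?_
    have h1 := (mem_cellBox hn i x).1 hx
    have h2 := (mem_cellBox hn j x).1 hx'
    have h3 : (i : ℝ) < j + 1 := by linarith
    have h4 : (j : ℝ) < i + 1 := by linarith
    have h5 : i < j + 1 := by exact_mod_cast h3
    have h6 : j < i + 1 := by exact_mod_cast h4
    rw [show i = j by omega]
  -- Tags are functions of the box, so the index is recovered from the lower endpoint.
  tag J := fun _ => t ⌊(n : ℝ) * J.lower 0⌋₊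
  tag_mem_Icc := by
    intro J
    rw [mem_Icc_intervalBox]
    exact ht _

theorem mem_uniformPartition {n : ℕ} {hn : 0 < n} {t : ℕ → ℝ} {ht : ∀ i, t i ∈ Icc (0 : ℝ) 1}
    {J : BoxIntegral.Box (Fin 1)} :
    J ∈ uniformPartition n hn t ht ↔ ∃ i < n, cellBox n hn i = J := by
  change J ∈ Finset.map _ _ ↔ _
  simp

theorem uniformPartition_tag {n : ℕ} {hn : 0 < n} {t : ℕ → ℝ} {ht : ∀ i, t i ∈ Icc (0 : ℝ) 1}
    (i : ℕ) : (uniformPartition n hn t ht).tag (cellBox n hn i) = fun _ => t i := by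
  change (fun _ => t _) = _
  rw [cellBox_index]

theorem isPartition_uniformPartition {n : ℕ} {hn : 0 < n} {t : ℕ → ℝ}
    {ht : ∀ i, t i ∈ Icc (0 : ℝ) 1} : (uniformPartition n hn t ht).IsPartition := by
  intro x hx
  rw [mem_intervalBox] at hx
  have h0 : (0 : ℝ) < n := by exact_mod_cast hn
  have hpos : 0 < (n : ℝ) * x 0 := mul_pos h0 hx.1
  have hc : 0 < ⌈(n : ℝ) * x 0⌉₊ := Nat.ceil_pos.2 hpos
  have hle : ⌈(n : ℝ) * x 0⌉₊ ≤ n := Nat.ceil_le.2 (by nlinarith [hx.2])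
  obtain ⟨i, hi⟩ : ∃ i, ⌈(n : ℝ) * x 0⌉₊ = i + 1 := ⟨_, (Nat.succ_pred_eq_of_pos hc).symm⟩
  refine ⟨cellBox n hn i, mem_uniformPartition.2 ⟨i, by omega, rfl⟩, ?_⟩
  rw [mem_cellBox]
  have h1 := Nat.le_ceil ((n : ℝ) * x 0)
  have h2 := Nat.ceil_lt_add_one hpos.le
  rw [hi] at h1 h2
  push_cast at h1 h2
  exact ⟨by linarith, by linarith⟩

theorem integralSum_uniformPartition {n : ℕ} {hn : 0 < n} {t : ℕ → ℝ}
    {ht : ∀ i, t i ∈ Icc (0 : ℝ) 1} (g : ℝ → ℂ) :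
    BoxIntegral.integralSum (fun x : Fin 1 → ℝ => g (x 0))
      ((volume : Measure (Fin 1 → ℝ)).toBoxAdditive.toSMul (E := ℂ)) (uniformPartition n hn t ht)
      = ∑ i ∈ Finset.range n, (1 / (n : ℝ)) • g (t i) := by
  change ∑ J ∈ Finset.map _ _, _ = _
  rw [Finset.sum_map]
  refine Finset.sum_congr rfl fun i _ => ?_
  simp only [Function.Embedding.coeFn_mk, uniformPartition_tag,
    BoxIntegral.BoxAdditiveMap.toSMul_apply, Measure.toBoxAdditive_apply]
  rw [cellBox, measureReal_intervalBox]
  congr 1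
  ring

/-- `t` selects a point in each cell of the uniform subdivision of `[0, 1]` into `n` cells. -/
def IsCellSelection (n : ℕ) (t : ℕ → ℝ) : Prop :=
  (∀ i, t i ∈ Icc (0 : ℝ) 1) ∧ ∀ i < n, t i ∈ Icc ((i : ℝ) / n) (((i : ℝ) + 1) / n)

/-- The Cauchy criterion compares two Riemann sums over the same uniform partition with different
tags. The Riemann gauge is constant, so a mesh 1/n below it suffices. -/
theorem RiemannIntegrableIcc.exists_uniform_sum_sub_le {g : ℝ → ℂ}
    (hg : RiemannIntegrableIcc g 0 1) {ε : ℝ} (hε : 0 < ε) :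
    ∃ n : ℕ, 0 < n ∧ ∀ t t' : ℕ → ℝ, IsCellSelection n t → IsCellSelection n t' →
      ‖∑ i ∈ Finset.range n, (g (t i) - g (t' i))‖ ≤ n * ε := by
  obtain ⟨r, hr, H⟩ := BoxIntegral.integrable_iff_cauchy_basis.1 (hg zero_lt_one) ε hε
  obtain ⟨n, hn⟩ := exists_nat_gt (1 / (r 0 0 : ℝ))
  have hr0 : (0 : ℝ) < r 0 0 := (r 0 0).2
  have hn0 : (0 : ℝ) < n := lt_trans (by positivity) hn
  have hnpos : 0 < n := by exact_mod_cast hn0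
  have hnr : 1 / (n : ℝ) ≤ r 0 0 := by
    rw [div_le_iff₀ hn0]
    rw [div_lt_iff₀ hr0] at hn
    linarith
  have key : ∀ t : ℕ → ℝ, ∀ ht : IsCellSelection n t,
      BoxIntegral.IntegrationParams.Riemann.MemBaseSet (intervalBox 0 1 zero_lt_one) 0 (r 0)
        (uniformPartition n hnpos t ht.1) := by
    intro t ht
    refine ⟨?_, ?_, ?_, ?_⟩
    · intro J hJ
      obtain ⟨i, hi, rfl⟩ := mem_uniformPartition.1 hJ
      rw [uniformPartition_tag]
      intro x hx
      rw [cellBox, mem_Icc_intervalBox] at hx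
      rw [hr 0 rfl, mem_closedBall_iff_norm, pi_norm_le_iff_of_nonneg hr0.le]
      intro j
      rw [Fin.fin_one_eq_zero j]
      have h1 := ht.2 i hi
      have h2 : ((i : ℝ) + 1) / n = i / n + 1 / n := by ring
      rw [h2] at hx h1
      simp only [Pi.sub_apply, Real.norm_eq_abs]
      rw [abs_le]
      constructor <;> linarith [hx.1, hx.2, h1.1, h1.2]
    · intro _ J hJ
      obtain ⟨i, hi, rfl⟩ := mem_uniformPartition.1 hJ
      rw [uniformPartition_tag, cellBox, mem_Icc_intervalBox]
      exact ht.2 i hi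
    · intro h
      exact absurd h (by decide)
    · intro h
      exact absurd h (by decide)
  refine ⟨n, hnpos, fun t t' ht ht' => ?_⟩
  have := H 0 0 _ _ (key t ht) isPartition_uniformPartition (key t' ht')
    isPartition_uniformPartition
  rw [integralSum_uniformPartition, integralSum_uniformPartition, dist_eq_norm,
    ← Finset.sum_sub_distrib] at this
  simp_rw [← smul_sub] at this
  rw [← Finset.smul_sum, norm_smul, Real.norm_of_nonneg (by positivity), one_div,
    inv_mul_le_iff₀ hn0] at this
  exact this

/-- Take `o i` to be the supremum of differences on the cell. Varying the tags in one cell only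
shows it is finite; near-maximising pairs in all cells at once bound the sum. Real values are
essential: the differences can all be given the same sign. -/
theorem exists_oscillation_bound {n : ℕ} (hn : 0 < n) {u : ℝ → ℝ} {ε : ℝ} (hε : 0 < ε)
    (hu : ∀ t t' : ℕ → ℝ, IsCellSelection n t → IsCellSelection n t' →
      ∑ i ∈ Finset.range n, (u (t i) - u (t' i)) ≤ n * ε) :
    ∃ o : ℕ → ℝ, (∀ i < n, ∀ x ∈ Icc ((i : ℝ) / n) (((i : ℝ) + 1) / n),
      ∀ y ∈ Icc ((i : ℝ) / n) (((i : ℝ) + 1) / n), |u x - u y| ≤ o i) ∧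
      ∑ i ∈ Finset.range n, o i ≤ 2 * n * ε := by
  classical
  have hn0 : (0 : ℝ) < n := by exact_mod_cast hn
  let c : ℕ → Set ℝ := fun i => Icc ((i : ℝ) / n) (((i : ℝ) + 1) / n)
  have hc01 : ∀ i < n, c i ⊆ Icc 0 1 := by
    intro i hi
    have : (i : ℝ) + 1 ≤ n := by exact_mod_cast hi
    exact Icc_subset_Icc (by positivity) (by rw [div_le_one hn0]; exact this)
  have hleft : ∀ i, (i : ℝ) / n ∈ c i := fun i => ⟨le_rfl, (div_lt_succ_div hn i).le⟩
  -- extend a selection over the cells by zero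
  have hsel : ∀ t : ℕ → ℝ, (∀ i < n, t i ∈ c i) →
      IsCellSelection n (fun i => if i < n then t i else 0) := by
    intro t ht
    refine ⟨fun i => ?_, fun i hi => ?_⟩
    · dsimp only
      split_ifs with hi
      · exact hc01 i hi (ht i hi)
      · simp
    · simpa only [hi, if_true] using ht i hi
  have hu' : ∀ t t' : ℕ → ℝ, (∀ i < n, t i ∈ c i) → (∀ i < n, t' i ∈ c i) →
      ∑ i ∈ Finset.range n, (u (t i) - u (t' i)) ≤ n * ε := by
    intro t t' ht ht'
    refine le_trans (le_of_eq ?_) (hu _ _ (hsel t ht) (hsel t' ht'))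
    refine Finset.sum_congr rfl fun i hi => ?_
    simp [Finset.mem_range.1 hi]
  let d : ℕ → Set ℝ := fun i => (fun p : ℝ × ℝ => u p.1 - u p.2) '' (c i ×ˢ c i)
  have hbdd : ∀ i < n, BddAbove (d i) := by
    intro i hi
    refine ⟨n * ε, ?_⟩
    rintro _ ⟨⟨x, y⟩, ⟨hx, hy⟩, rfl⟩
    refine le_trans (le_of_eq ?_) (hu' (fun j => if j = i then x else j / n)
      (fun j => if j = i then y else j / n) ?_ ?_)
    · rw [Finset.sum_eq_single i]
      · simp
      · intro j _ hj
        simp [hj]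
      · intro h
        exact absurd (Finset.mem_range.2 hi) h
    · intro j _
      by_cases h : j = i
      · subst h
        simpa using hx
      · simpa [h] using hleft j
    · intro j _
      by_cases h : j = i
      · subst h
        simpa using hy
      · simpa [h] using hleft j
  have hne : ∀ i, (d i).Nonempty := fun i => ⟨_, ⟨(_, _), ⟨hleft i, hleft i⟩, rfl⟩⟩
  refine ⟨fun i => sSup (d i), ?_, ?_⟩
  · intro i hi x hx y hy
    rw [abs_le']
    constructor
    · exact le_csSup (hbdd i hi) ⟨(x, y), ⟨hx, hy⟩, rfl⟩
    · exact le_csSup (hbdd i hi) ⟨(y, x), ⟨hy, hx⟩, by simp⟩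
  · have : ∀ i, ∃ p : ℝ × ℝ, p ∈ c i ×ˢ c i ∧ sSup (d i) - ε < u p.1 - u p.2 := by
      intro i
      obtain ⟨_, ⟨p, hp, rfl⟩, h⟩ := exists_lt_of_lt_csSup (hne i) (sub_lt_self (sSup (d i)) hε)
      exact ⟨p, hp, h⟩
    choose p hp hlt using this
    have h1 := hu' (fun i => (p i).1) (fun i => (p i).2) (fun i _ => (hp i).1)
      (fun i _ => (hp i).2)
    have h2 : ∑ i ∈ Finset.range n, (sSup (d i) - ε)
        ≤ ∑ i ∈ Finset.range n, (u (p i).1 - u (p i).2) :=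
      Finset.sum_le_sum fun i _ => (hlt i).le
    rw [Finset.sum_sub_distrib, Finset.sum_const, Finset.card_range, nsmul_eq_mul] at h2
    linarith

/-- Complex differences may cancel in the sum, so real and imaginary parts are treated separately;
each costs n ε / 2. -/
theorem RiemannIntegrableIcc.exists_oscillation_bound {g : ℝ → ℂ}
    (hg : RiemannIntegrableIcc g 0 1) {ε : ℝ} (hε : 0 < ε) :
    ∃ n : ℕ, 0 < n ∧ ∃ o : ℕ → ℝ, (∀ i < n, ∀ x ∈ Icc ((i : ℝ) / n) (((i : ℝ) + 1) / n),
      ∀ y ∈ Icc ((i : ℝ) / n) (((i : ℝ) + 1) / n), ‖g x - g y‖ ≤ o i) ∧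
      ∑ i ∈ Finset.range n, o i ≤ n * ε := by
  obtain ⟨n, hn, H⟩ := hg.exists_uniform_sum_sub_le (ε := ε / 4) (by positivity)
  obtain ⟨o₁, h₁, hs₁⟩ := SobolAverage.exists_oscillation_bound hn (u := fun x => (g x).re)
    (ε := ε / 4) (by positivity) (fun t t' ht ht' => by
      refine le_trans ?_ (H t t' ht ht')
      refine le_trans (le_of_eq ?_) (Complex.re_le_norm _)
      simp)
  obtain ⟨o₂, h₂, hs₂⟩ := SobolAverage.exists_oscillation_bound hn (u := fun x => (g x).im)
    (ε := ε / 4) (by positivity) (fun t t' ht ht' => by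
      refine le_trans ?_ (H t t' ht ht')
      refine le_trans (le_of_eq ?_) ((le_abs_self _).trans (Complex.abs_im_le_norm _))
      simp)
  refine ⟨n, hn, fun i => o₁ i + o₂ i, fun i hi x hx y hy => ?_, ?_⟩
  · refine (Complex.norm_le_abs_re_add_abs_im _).trans ?_
    simpa using add_le_add (h₁ i hi x hx y hy) (h₂ i hi x hx y hy)
  · rw [Finset.sum_add_distrib]
    linarith

/-! ### Indicators of arcs along exponential sequences -/

/-- The `1`-periodic extension of the indicator function of `[u, v) ⊆ [0, 1)`. -/
noncomputable def arc (u v y : ℝ) : ℝ := (Ico u v).indicator 1 (Int.fract y)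

theorem arc_nonneg (u v y : ℝ) : 0 ≤ arc u v y := indicator_nonneg (fun _ _ => zero_le_one) _

theorem arc_le_one (u v y : ℝ) : arc u v y ≤ 1 :=
  indicator_le' (fun _ _ => le_rfl) (fun _ _ => zero_le_one) _

theorem arc_of_mem {u v y : ℝ} (h : Int.fract y ∈ Ico u v) : arc u v y = 1 := by simp [arc, h]

theorem measurable_arc (u v : ℝ) : Measurable (arc u v) :=
  (measurable_one.indicator measurableSet_Ico).comp measurable_fract

theorem periodic_arc (u v : ℝ) : Function.Periodic (arc u v) 1 := by
  intro y
  simp [arc]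

theorem arc_eq_indicator {u v y : ℝ} (k : ℤ) (hy : y ∈ Ico (k : ℝ) (k + 1)) :
    arc u v y = (Ico (k + u) (k + v)).indicator 1 y := by
  have h : Int.fract y = y - k := by
    rw [Int.fract, Int.floor_eq_iff.2 hy]
  rw [arc, h]
  simp only [indicator, mem_Ico, le_sub_iff_add_le', sub_lt_iff_lt_add', Pi.one_apply]

/-- The indicator function of an arc, minus its mean. -/
noncomputable def centeredArc (u v y : ℝ) : ℝ := arc u v y - (v - u)

theorem measurable_centeredArc (u v : ℝ) : Measurable (centeredArc u v) :=
  (measurable_arc u v).sub_const _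

theorem periodic_centeredArc (u v : ℝ) : Function.Periodic (centeredArc u v) 1 := by
  intro y
  rw [centeredArc, periodic_arc u v y, centeredArc]

theorem abs_centeredArc_le {u v : ℝ} (hu : 0 ≤ u) (huv : u ≤ v) (hv : v ≤ 1) (y : ℝ) :
    |centeredArc u v y| ≤ 1 := by
  have h1 := arc_nonneg u v y
  have h2 := arc_le_one u v y
  rw [centeredArc, abs_le]
  constructor <;> linarith

theorem intervalIntegrable_of_abs_le {g : ℝ → ℝ} (hg : Measurable g) {M : ℝ}
    (hM : ∀ y, |g y| ≤ M) (p q : ℝ) : IntervalIntegrable g volume p q :=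
  (intervalIntegrable_const (c := M)).mono_fun hg.aestronglyMeasurable
    (ae_of_all _ fun y => (hM y).trans (le_abs_self M))

theorem integral_Ioc_inter_Ico {p q c d : ℝ} (g : ℝ → ℝ) :
    ∫ y in Ioc p q ∩ Ico c d, g y = ∫ y in Ioc (max p c) (min q d), g y := by
  rw [← Ioc_inter_Ioc]
  exact setIntegral_congr_set ((ae_eq_refl _).inter Ico_ae_eq_Ioc)

/-- Within one period the arc is a single interval, so a bound on all interval integrals of `g`
survives multiplication by the arc. -/
theorem integral_arc_mul_of_cell {u v : ℝ} (g : ℝ → ℝ) (k : ℤ) {p q : ℝ} (hp : (k : ℝ) ≤ p)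
    (hpq : p ≤ q) (hq : q ≤ k + 1) :
    ∫ y in p..q, arc u v y * g y = ∫ y in Ioc (max p (k + u)) (min q (k + v)), g y := by
  rw [← integral_Ioc_inter_Ico, ← setIntegral_indicator measurableSet_Ico,
    intervalIntegral.integral_of_le hpq, ← integral_Ico_eq_integral_Ioc,
    ← integral_Ico_eq_integral_Ioc]
  refine setIntegral_congr_fun measurableSet_Ico fun y hy => ?_
  rw [arc_eq_indicator k ⟨hp.trans hy.1, hy.2.trans_le hq⟩]
  by_cases h : y ∈ Ico (k + u) (k + v)
  · simp [indicator_of_mem h]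
  · simp [indicator_of_notMem h]

theorem integral_centeredArc {u v : ℝ} (hu : 0 ≤ u) (huv : u ≤ v) (hv : v ≤ 1) :
    ∫ y in (0 : ℝ)..1, centeredArc u v y = 0 := by
  have h := integral_arc_mul_of_cell (u := u) (v := v) (fun _ => 1) 0 (p := 0) (q := 1)
    (by simp) (by simp) (by simp)
  simp only [mul_one, Int.cast_zero, zero_add, max_eq_right hu, min_eq_right hv,
    integral_const, measureReal_restrict_apply_univ, Real.volume_real_Ioc_of_le huv,
    smul_eq_mul] at h
  unfold centeredArc
  rw [intervalIntegral.integral_sub, h]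
  · simp
  · exact intervalIntegrable_of_abs_le (measurable_arc u v) (M := 1)
      (fun y => abs_le.2 ⟨by linarith [arc_nonneg u v y], arc_le_one u v y⟩) _ _
  · exact intervalIntegrable_const

/-- Whole periods integrate to zero, leaving a piece of length less than 1. -/
theorem abs_integral_centeredArc_le {u v : ℝ} (hu : 0 ≤ u) (huv : u ≤ v) (hv : v ≤ 1)
    (p q : ℝ) : |∫ y in p..q, centeredArc u v y| ≤ 1 := by
  have hint := intervalIntegrable_of_abs_le (measurable_centeredArc u v)
    (abs_centeredArc_le hu huv hv)
  have hper := periodic_centeredArc u v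
  have h0 : ∫ y in p..p + ⌊q - p⌋ • (1 : ℝ), centeredArc u v y = 0 := by
    rw [hper.intervalIntegral_add_zsmul_eq ⌊q - p⌋ p hint, hper.intervalIntegral_add_eq p 0,
      zero_add, integral_centeredArc hu huv hv, smul_zero]
  rw [← intervalIntegral.integral_add_adjacent_intervals (hint p (p + ⌊q - p⌋ • (1 : ℝ)))
    (hint _ q), h0, zero_add]
  refine (intervalIntegral.norm_integral_le_of_norm_le_const (f := centeredArc u v) (C := 1)
    (fun y _ => abs_centeredArc_le hu huv hv y)).trans ?_
  have h1 := Int.floor_le (q - p)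
  have h2 := Int.lt_floor_add_one (q - p)
  rw [one_mul, abs_le]
  simp only [zsmul_eq_mul, mul_one]
  constructor <;> linarith

theorem abs_integral_centeredArc_comp_mul_le {u v : ℝ} (hu : 0 ≤ u) (huv : u ≤ v) (hv : v ≤ 1)
    {c : ℝ} (hc : c ≠ 0) (p q : ℝ) : |∫ y in p..q, centeredArc u v (c * y)| ≤ |c|⁻¹ := by
  rw [intervalIntegral.integral_comp_mul_left _ hc, smul_eq_mul, abs_mul, abs_inv]
  exact mul_le_of_le_one_right (by positivity) (abs_integral_centeredArc_le hu huv hv _ _)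

/-- At most |q - p| + 2 unit cells are involved, and each contributes at most κ. The bound M serves
only for integrability. -/
theorem abs_integral_arc_mul_le {u v : ℝ} {g : ℝ → ℝ} {κ M : ℝ} (hg : Measurable g)
    (hM : ∀ y, |g y| ≤ M) (hκ : ∀ p q, |∫ y in p..q, g y| ≤ κ) (p q : ℝ) :
    |∫ y in p..q, arc u v y * g y| ≤ κ * (|q - p| + 2) := by
  have hκ0 : 0 ≤ κ := (abs_nonneg _).trans (hκ 0 0)
  have hint : ∀ p q, IntervalIntegrable (fun y => arc u v y * g y) volume p q :=
    intervalIntegrable_of_abs_le ((measurable_arc u v).mul hg) (M := M) fun y => by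
      rw [abs_mul, abs_of_nonneg (arc_nonneg u v y)]
      exact (mul_le_of_le_one_left (abs_nonneg _) (arc_le_one u v y)).trans (hM y)
  have hcell : ∀ (k : ℤ) (p q : ℝ), (k : ℝ) ≤ p → p ≤ q → q ≤ k + 1 →
      |∫ y in p..q, arc u v y * g y| ≤ κ := by
    intro k p q hp hpq hq
    rw [integral_arc_mul_of_cell g k hp hpq hq]
    rcases le_total (max p (k + u)) (min q (k + v)) with h | h
    · rw [← intervalIntegral.integral_of_le h]
      exact hκ _ _
    · rw [Ioc_eq_empty (not_lt.2 h)]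
      simpa using hκ0
  have hind : ∀ (p : ℝ) (n : ℕ) (q : ℝ), p ≤ q → q ≤ ⌊p⌋ + 1 + n →
      |∫ y in p..q, arc u v y * g y| ≤ κ * (n + 1) := by
    intro p n
    induction n with
    | zero =>
      intro q hpq hq
      simpa using hcell ⌊p⌋ p q (Int.floor_le p) hpq (by simpa using hq)
    | succ n ih =>
      intro q hpq hq
      rcases le_total q (⌊p⌋ + 1 + n) with h | h
      · refine (ih q hpq h).trans ?_
        push_cast
        gcongr
        linarith
      · have h1 : p ≤ ⌊p⌋ + 1 + n := by
          have := Int.lt_floor_add_one p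
          have : (0 : ℝ) ≤ n := by positivity
          linarith
        rw [← intervalIntegral.integral_add_adjacent_intervals (hint p (⌊p⌋ + 1 + n)) (hint _ q)]
        refine (abs_add_le _ _).trans ?_
        have h2 := ih _ h1 le_rfl
        have h3 := hcell (⌊p⌋ + 1 + n) (⌊p⌋ + 1 + n) q (by push_cast; rfl) h
          (by push_cast at hq ⊢; linarith)
        push_cast
        linarith
  have hle : ∀ p q : ℝ, p ≤ q → |∫ y in p..q, arc u v y * g y| ≤ κ * (q - p + 2) := by
    intro p q hpq
    have h1 := Nat.le_ceil (q - p)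
    have h2 := Nat.ceil_lt_add_one (sub_nonneg.2 hpq)
    have h3 := Int.lt_floor_add_one p
    exact (hind p ⌈q - p⌉₊ q hpq (by linarith)).trans
      (mul_le_mul_of_nonneg_left (by linarith) hκ0)
  rcases le_total p q with h | h
  · rw [abs_of_nonneg (sub_nonneg.2 h)]
    exact hle p q h
  · rw [intervalIntegral.integral_symm, abs_neg, abs_sub_comm, abs_of_nonneg (sub_nonneg.2 h)]
    exact hle q p h

/-- Rescale by αᵐ. The slow arc cuts out at most |α|ᵐ(b - a) + 2 intervals, on each of which the
fast factor integrates to at most |α|^{-(n-m)}; the Jacobian removes |α|ᵐ. The constant part v - u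
of the slow factor adds at most one more such term, whence the 3. -/
theorem abs_integral_centeredArc_mul_le {α : ℝ} (hα : 1 < |α|) {u v : ℝ} (hu : 0 ≤ u)
    (huv : u ≤ v) (hv : v ≤ 1) {a b : ℝ} (hab : a ≤ b) {m n : ℕ} (hmn : m ≤ n) :
    |∫ x in a..b, centeredArc u v (α ^ m * x) * centeredArc u v (α ^ n * x)|
      ≤ (b - a + 3) * |α|⁻¹ ^ (n - m) := by
  have hα0 : α ≠ 0 := by
    rintro rfl
    norm_num at hα
  have hψ : Measurable (centeredArc u v) := measurable_centeredArc u v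
  have hm := abs_centeredArc_le hu huv hv
  have hαm : 1 ≤ |α| ^ m := one_le_pow₀ hα.le
  have h1 : |∫ x in a..b, arc u v (α ^ m * x) * centeredArc u v (α ^ n * x)|
      ≤ (b - a + 2) * |α|⁻¹ ^ (n - m) := by
    have h := intervalIntegral.integral_comp_mul_left (a := a) (b := b)
      (fun y => arc u v y * centeredArc u v (α ^ (n - m) * y)) (pow_ne_zero m hα0)
    have h' : ∀ x, α ^ (n - m) * (α ^ m * x) = α ^ n * x := fun x => by
      rw [← mul_assoc, ← pow_add, Nat.sub_add_cancel hmn]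
    simp only [h'] at h
    rw [h, smul_eq_mul, abs_mul, abs_inv, abs_pow]
    have h2 := abs_integral_arc_mul_le (u := u) (v := v) (M := 1)
      (g := fun y => centeredArc u v (α ^ (n - m) * y)) (hψ.comp (measurable_const_mul _))
      (fun y => hm _)
      (abs_integral_centeredArc_comp_mul_le hu huv hv (pow_ne_zero (n - m) hα0))
      (α ^ m * a) (α ^ m * b)
    rw [← mul_sub, abs_mul, abs_of_nonneg (sub_nonneg.2 hab), abs_pow, abs_pow, ← inv_pow] at h2
    rw [inv_mul_le_iff₀ (by positivity)]
    refine h2.trans ?_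
    have h3 : 0 ≤ |α|⁻¹ ^ (n - m) := by positivity
    nlinarith [mul_nonneg h3 (sub_nonneg.2 hαm)]
  have h2 : |∫ x in a..b, centeredArc u v (α ^ n * x)| ≤ |α|⁻¹ ^ (n - m) := by
    refine (abs_integral_centeredArc_comp_mul_le hu huv hv (pow_ne_zero n hα0) a b).trans ?_
    rw [abs_pow, ← inv_pow]
    exact pow_le_pow_of_le_one (by positivity) (inv_le_one_of_one_le₀ hα.le) (Nat.sub_le n m)
  have h3 : ∀ c : ℝ, IntervalIntegrable (fun x => centeredArc u v (c * x)) volume a b := fun c =>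
    intervalIntegrable_of_abs_le (hψ.comp (measurable_const_mul _)) (fun y => hm _) a b
  have h4 : ∫ x in a..b, centeredArc u v (α ^ m * x) * centeredArc u v (α ^ n * x)
      = (∫ x in a..b, arc u v (α ^ m * x) * centeredArc u v (α ^ n * x))
        - (v - u) * ∫ x in a..b, centeredArc u v (α ^ n * x) := by
    rw [← intervalIntegral.integral_const_mul, ← intervalIntegral.integral_sub]
    · refine intervalIntegral.integral_congr fun x _ => ?_
      simp only [centeredArc]
      ring
    · refine intervalIntegrable_of_abs_le (M := 1) (((measurable_arc u v).comp
        (measurable_const_mul _)).mul (hψ.comp (measurable_const_mul _))) (fun y => ?_) a b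
      rw [Pi.mul_apply, abs_mul, Function.comp_apply, abs_of_nonneg (arc_nonneg u v _)]
      exact mul_le_one₀ (arc_le_one u v _) (abs_nonneg _) (hm _)
    · exact (h3 _).const_mul _
  rw [h4]
  refine (abs_sub _ _).trans ?_
  rw [abs_mul, abs_of_nonneg (sub_nonneg.2 huv)]
  have h5 := mul_le_mul (show v - u ≤ 1 by linarith) h2 (abs_nonneg _) zero_le_one
  linarith

theorem sum_pow_sub_le {r : ℝ} (h0 : 0 ≤ r) (h1 : r < 1) (N : ℕ) :
    ∑ m ∈ Finset.range N, r ^ (N - m) ≤ (1 - r)⁻¹ := by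
  rw [← tsum_geometric_of_lt_one h0 h1]
  refine le_trans ?_ ((summable_geometric_of_lt_one h0 h1).sum_le_tsum (Finset.range N)
    fun i _ => by positivity)
  rw [← Finset.sum_range_reflect]
  refine Finset.sum_le_sum fun m hm => pow_le_pow_of_le_one h0 h1.le ?_
  rw [Finset.mem_range] at hm
  omega

/-- The sum of the centered indicator function of an arc along `x, α x, …, α ^ (N - 1) x`. -/
noncomputable def arcSum (α u v : ℝ) (N : ℕ) (x : ℝ) : ℝ :=
  ∑ n ∈ Finset.range N, centeredArc u v (α ^ n * x)

theorem measurable_arcSum (α u v : ℝ) (N : ℕ) : Measurable (arcSum α u v N) :=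
  Finset.measurable_fun_sum _ fun _ _ =>
    (measurable_centeredArc u v).comp (measurable_const_mul _)

theorem abs_arcSum_le {α u v : ℝ} (hu : 0 ≤ u) (huv : u ≤ v) (hv : v ≤ 1) (N : ℕ) (x : ℝ) :
    |arcSum α u v N x| ≤ N := by
  refine (Finset.abs_sum_le_sum_abs _ _).trans ?_
  refine (Finset.sum_le_sum fun n _ => abs_centeredArc_le hu huv hv _).trans ?_
  simp

/-- Each new term adds its square and its correlations with earlier terms, which sum geometrically.
The constant does not depend on the arc, as needed when many dyadic arcs are treated together. -/
theorem integral_arcSum_sq_le {α : ℝ} (hα : 1 < |α|) {u v : ℝ} (hu : 0 ≤ u)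
    (huv : u ≤ v) (hv : v ≤ 1) {a b : ℝ} (hab : a ≤ b) (N : ℕ) :
    ∫ x in a..b, arcSum α u v N x ^ 2 ≤ (b - a + 3) * (2 * (1 - |α|⁻¹)⁻¹ + 1) * N := by
  have hr1 : |α|⁻¹ < 1 := inv_lt_one_of_one_lt₀ hα
  have hm := abs_centeredArc_le hu huv hv
  induction N with
  | zero => simp [arcSum]
  | succ N ih =>
    have hψ : ∀ n : ℕ, Measurable fun x => centeredArc u v (α ^ n * x) := fun n =>
      (measurable_centeredArc u v).comp (measurable_const_mul _)
    have hint : ∀ n : ℕ, IntervalIntegrable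
        (fun x => centeredArc u v (α ^ n * x) * centeredArc u v (α ^ N * x)) volume a b := fun n =>
      intervalIntegrable_of_abs_le ((hψ n).mul (hψ N)) (M := 1) (fun y => by
        rw [Pi.mul_apply, abs_mul]
        exact mul_le_one₀ (hm _) (abs_nonneg _) (hm _)) a b
    have hsq : IntervalIntegrable (fun x => arcSum α u v N x ^ 2) volume a b :=
      intervalIntegrable_of_abs_le ((measurable_arcSum α u v N).pow_const 2) (M := (N : ℝ) ^ 2)
        (fun y => by
          rw [abs_pow]
          exact pow_le_pow_left₀ (abs_nonneg _) (abs_arcSum_le hu huv hv N y) 2) a b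
    have hexp : ∀ x, arcSum α u v (N + 1) x ^ 2 = arcSum α u v N x ^ 2
        + (2 * ∑ n ∈ Finset.range N, centeredArc u v (α ^ n * x) * centeredArc u v (α ^ N * x)
          + centeredArc u v (α ^ N * x) * centeredArc u v (α ^ N * x)) := by
      intro x
      rw [← Finset.sum_mul]
      simp only [arcSum, Finset.sum_range_succ]
      ring
    have hsum : IntervalIntegrable (fun x => ∑ n ∈ Finset.range N,
        centeredArc u v (α ^ n * x) * centeredArc u v (α ^ N * x)) volume a b := by
      have := IntervalIntegrable.sum (Finset.range N) fun n _ => hint n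
      simpa only [Finset.sum_fn] using this
    simp_rw [hexp]
    rw [intervalIntegral.integral_add hsq ((hsum.const_mul 2).add (hint N)),
      intervalIntegral.integral_add (hsum.const_mul 2) (hint N),
      intervalIntegral.integral_const_mul,
      intervalIntegral.integral_finsetSum fun n _ => hint n]
    have h1 : ∑ n ∈ Finset.range N, ∫ x in a..b,
        centeredArc u v (α ^ n * x) * centeredArc u v (α ^ N * x)
        ≤ (b - a + 3) * (1 - |α|⁻¹)⁻¹ := by
      refine le_trans (Finset.sum_le_sum fun n hn => (le_abs_self _).trans
        (abs_integral_centeredArc_mul_le hα hu huv hv hab (Finset.mem_range.1 hn).le)) ?_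
      rw [← Finset.mul_sum]
      exact mul_le_mul_of_nonneg_left (sum_pow_sub_le (by positivity) hr1 N) (by linarith)
    have h2 := (le_abs_self _).trans
      (abs_integral_centeredArc_mul_le hα hu huv hv hab (le_refl N))
    rw [Nat.sub_self, pow_zero] at h2
    push_cast
    linarith

/-! ### Almost sure statements -/

/-- By Tonelli the series of the `g j` has finite integral on each bounded interval, so it converges
almost everywhere and its terms vanish. -/
theorem ae_tendsto_zero_of_summable_integral {g : ℕ → ℝ → ℝ} (hg0 : ∀ j x, 0 ≤ g j x)
    (hgi : ∀ j a b, IntervalIntegrable (g j) volume a b)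
    (hgs : ∀ R : ℕ, ∃ c : ℕ → ℝ, Summable c ∧ ∀ j, ∫ x in (-R : ℝ)..R, g j x ≤ c j) :
    ∀ᵐ x : ℝ, Tendsto (fun j => g j x) atTop (𝓝 0) := by
  have key : ∀ R : ℕ, ∀ᵐ x : ℝ, x ∈ Ioc (-R : ℝ) R → Tendsto (fun j => g j x) atTop (𝓝 0) := by
    intro R
    obtain ⟨c, hc, hgc⟩ := hgs R
    have hR : (-R : ℝ) ≤ R := by linarith [(Nat.cast_nonneg R : (0 : ℝ) ≤ R)]
    have hint : ∀ j, IntegrableOn (g j) (Ioc (-R : ℝ) R) := fun j =>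
      (intervalIntegrable_iff_integrableOn_Ioc_of_le hR).1 (hgi j _ _)
    have hl : ∀ j, ∫⁻ x in Ioc (-R : ℝ) R, ENNReal.ofReal (g j x) ≤ ENNReal.ofReal (c j) := by
      intro j
      rw [← ofReal_integral_eq_lintegral_ofReal (hint j) (ae_of_all _ (hg0 j)),
        ← intervalIntegral.integral_of_le hR]
      exact ENNReal.ofReal_le_ofReal (hgc j)
    have hfin : ∫⁻ x in Ioc (-R : ℝ) R, ∑' j, ENNReal.ofReal (g j x) ≠ ∞ := by
      rw [lintegral_tsum fun j => (hint j).aemeasurable.ennreal_ofReal]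
      exact ne_top_of_le_ne_top hc.tsum_ofReal_ne_top (ENNReal.tsum_le_tsum hl)
    have hae := ae_lt_top' (AEMeasurable.tsum fun j =>
      (hint j).aemeasurable.ennreal_ofReal) hfin
    rw [ae_restrict_iff' measurableSet_Ioc] at hae
    filter_upwards [hae] with x hx hxR
    have h := ENNReal.tendsto_atTop_zero_of_tsum_ne_top (hx hxR).ne
    have h' := (ENNReal.tendsto_toReal ENNReal.zero_ne_top).comp h
    simpa [Function.comp_def, ENNReal.toReal_ofReal (hg0 _ x)] using h'
  filter_upwards [ae_all_iff.2 key] with x hx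
  obtain ⟨R, hR⟩ := exists_nat_gt |x|
  exact hx R ⟨(abs_lt.1 hR).1, (abs_lt.1 hR).2.le⟩

theorem sum_arc_eq (α u v x : ℝ) (N : ℕ) :
    ∑ n ∈ Finset.range N, arc u v (α ^ n * x) = arcSum α u v N x + N * (v - u) := by
  simp only [arcSum, centeredArc, Finset.sum_sub_distrib, Finset.sum_const, Finset.card_range,
    nsmul_eq_mul]
  ring

theorem intervalIntegrable_arcSum_sq {α u v : ℝ} (hu : 0 ≤ u) (huv : u ≤ v) (hv : v ≤ 1) (N : ℕ)
    (a b : ℝ) : IntervalIntegrable (fun x => arcSum α u v N x ^ 2) volume a b :=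
  intervalIntegrable_of_abs_le ((measurable_arcSum α u v N).pow_const 2) (M := (N : ℝ) ^ 2)
    (fun y => by
      rw [abs_pow]
      exact pow_le_pow_left₀ (abs_nonneg _) (abs_arcSum_le hu huv hv N y) 2) a b

theorem eventually_succ_sq_le {a : ℝ} (ha : 1 < a) :
    ∀ᶠ n : ℕ in atTop, (((n + 1) ^ 2 : ℕ) : ℝ) ≤ a * ((n ^ 2 : ℕ) : ℝ) := by
  -- For n ≥ 1 the increment 2n + 1 is at most 3n, hence at most (a - 1)n² once n ≥ 3/(a - 1).
  obtain ⟨m, hm⟩ := exists_nat_gt (3 / (a - 1))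
  filter_upwards [eventually_ge_atTop m, eventually_ge_atTop 1] with n hn hn1
  have h1 : (1 : ℝ) ≤ n := by exact_mod_cast hn1
  have h2 : (m : ℝ) ≤ n := by exact_mod_cast hn
  have h3 : 3 < (a - 1) * n := by
    rw [div_lt_iff₀ (by linarith)] at hm
    nlinarith
  push_cast
  nlinarith

/-- At N = j² the averaged sum has second moment O(j⁻²). The gaps are filled using the uncentred
sums, which are monotone in N. -/
theorem ae_tendsto_arc_average {α : ℝ} (hα : 1 < |α|) {u v : ℝ} (hu : 0 ≤ u)
    (huv : u ≤ v) (hv : v ≤ 1) :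
    ∀ᵐ x : ℝ, Tendsto (fun N : ℕ => (∑ n ∈ Finset.range N, arc u v (α ^ n * x)) / N) atTop
      (𝓝 (v - u)) := by
  have hae : ∀ᵐ x : ℝ, Tendsto (fun j : ℕ => (1 / (j : ℝ) ^ 4) * arcSum α u v (j ^ 2) x ^ 2)
      atTop (𝓝 0) := by
    refine ae_tendsto_zero_of_summable_integral (fun j x => by positivity)
      (fun j a b => (intervalIntegrable_arcSum_sq hu huv hv _ a b).const_mul _) fun R => ?_
    refine ⟨fun j => ((R - (-R) + 3) * (2 * (1 - |α|⁻¹)⁻¹ + 1)) * (1 / (j : ℝ) ^ 2),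
      (Real.summable_one_div_nat_pow.2 one_lt_two).mul_left _, fun j => ?_⟩
    rw [intervalIntegral.integral_const_mul]
    have h := integral_arcSum_sq_le hα hu huv hv (a := -R) (b := R)
      (by linarith [(Nat.cast_nonneg R : (0 : ℝ) ≤ R)]) (j ^ 2)
    refine (mul_le_mul_of_nonneg_left h (by positivity)).trans (le_of_eq ?_)
    rcases Nat.eq_zero_or_pos j with rfl | hj
    · simp
    · have : (j : ℝ) ≠ 0 := by exact_mod_cast hj.ne'
      push_cast
      generalize (R - (-R) + 3 : ℝ) * (2 * (1 - |α|⁻¹)⁻¹ + 1) = K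
      field_simp
  filter_upwards [hae] with x hx
  refine tendsto_div_of_monotone_of_exists_subseq_tendsto_div
    (fun N => ∑ n ∈ Finset.range N, arc u v (α ^ n * x)) (v - u) ?_ fun a ha =>
      ⟨fun j => j ^ 2, eventually_succ_sq_le ha, tendsto_pow_atTop two_ne_zero, ?_⟩
  · intro m n hmn
    exact Finset.sum_le_sum_of_subset_of_nonneg (Finset.range_subset_range.2 hmn)
      fun _ _ _ => arc_nonneg _ _ _
  · have h1 : Tendsto (fun j : ℕ => arcSum α u v (j ^ 2) x / (j : ℝ) ^ 2) atTop (𝓝 0) := by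
      rw [tendsto_zero_iff_abs_tendsto_zero]
      have := (Real.continuous_sqrt.tendsto 0).comp hx
      rw [Real.sqrt_zero] at this
      refine this.congr fun j => ?_
      simp only [Function.comp_apply]
      rw [← Real.sqrt_sq_eq_abs]
      congr 1
      ring
    have h2 := h1.add_const (v - u)
    rw [zero_add] at h2
    refine h2.congr' ?_
    filter_upwards [eventually_ge_atTop 1] with j hj
    have : (j : ℝ) ≠ 0 := by exact_mod_cast (by omega : j ≠ 0)
    rw [sum_arc_eq]
    push_cast
    field_simp

/-! ### Arcs shrinking to a point -/

/-- The left end of the part of `(z - 2⁻ᵏ, z + 2⁻ᵏ)` in the unit interval. -/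
noncomputable def dyadicLeft (z : ℝ) (k : ℕ) : ℝ := max 0 (z - (1 / 2) ^ k)

/-- The right end of the part of `(z - 2⁻ᵏ, z + 2⁻ᵏ)` in the unit interval. -/
noncomputable def dyadicRight (z : ℝ) (k : ℕ) : ℝ := min 1 (z + (1 / 2) ^ k)

theorem dyadicLeft_nonneg (z : ℝ) (k : ℕ) : 0 ≤ dyadicLeft z k := le_max_left _ _

theorem dyadicRight_le_one (z : ℝ) (k : ℕ) : dyadicRight z k ≤ 1 := min_le_left _ _

theorem dyadicLeft_le_dyadicRight {z : ℝ} (hz : z ∈ Icc (0 : ℝ) 1) (k : ℕ) :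
    dyadicLeft z k ≤ dyadicRight z k := by
  have : (0 : ℝ) < (1 / 2) ^ k := by positivity
  exact (max_le hz.1 (by linarith)).trans (le_min hz.2 (by linarith))

theorem dyadicRight_sub_dyadicLeft_le (z : ℝ) (k : ℕ) :
    dyadicRight z k - dyadicLeft z k ≤ 2 * (1 / 2) ^ k := by
  have h1 : z - (1 / 2) ^ k ≤ dyadicLeft z k := le_max_right _ _
  have h2 : dyadicRight z k ≤ z + (1 / 2) ^ k := min_le_right _ _
  linarith

theorem mem_dyadic {z y : ℝ} {k : ℕ} (hy : y ∈ Ico (0 : ℝ) 1) (h : |y - z| < (1 / 2) ^ k) :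
    y ∈ Ico (dyadicLeft z k) (dyadicRight z k) := by
  rw [abs_lt] at h
  exact ⟨max_le hy.1 (by linarith), lt_min hy.2 (by linarith)⟩

theorem intervalIntegrable_arc (u v a b : ℝ) : IntervalIntegrable (arc u v) volume a b :=
  intervalIntegrable_of_abs_le (measurable_arc u v) (M := 1)
    (fun y => abs_le.2 ⟨by linarith [arc_nonneg u v y], arc_le_one u v y⟩) _ _

theorem integral_arc {u v : ℝ} (hu : 0 ≤ u) (huv : u ≤ v) (hv : v ≤ 1) :
    ∫ y in (0 : ℝ)..1, arc u v y = v - u := by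
  have h := integral_centeredArc hu huv hv
  unfold centeredArc at h
  rw [intervalIntegral.integral_sub (intervalIntegrable_arc u v _ _) intervalIntegrable_const] at h
  simp at h
  linarith

theorem integral_arc_le {u v : ℝ} (hu : 0 ≤ u) (huv : u ≤ v) (hv : v ≤ 1) {p q : ℝ}
    (hpq : p ≤ q) : ∫ y in p..q, arc u v y ≤ (q - p + 1) * (v - u) := by
  have h1 := Nat.le_ceil (q - p)
  have h2 := Nat.ceil_lt_add_one (sub_nonneg.2 hpq)
  have hper := periodic_arc u v
  have h3 : ∫ y in p..p + (⌈q - p⌉₊ : ℤ) • (1 : ℝ), arc u v y = ⌈q - p⌉₊ * (v - u) := by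
    rw [hper.intervalIntegral_add_zsmul_eq _ p (intervalIntegrable_arc u v),
      hper.intervalIntegral_add_eq p 0, zero_add, integral_arc hu huv hv]
    simp
  have h4 : ∫ y in p..q, arc u v y ≤ ∫ y in p..p + (⌈q - p⌉₊ : ℤ) • (1 : ℝ), arc u v y := by
    refine intervalIntegral.integral_mono_interval le_rfl hpq ?_
      (ae_of_all _ fun y => arc_nonneg u v y) (intervalIntegrable_arc u v _ _)
    simp only [zsmul_eq_mul, mul_one, Int.cast_natCast]
    linarith
  rw [h3] at h4
  exact h4.trans (mul_le_mul_of_nonneg_right (by linarith) (sub_nonneg.2 huv))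

theorem integral_arc_comp_mul_le {u v : ℝ} (hu : 0 ≤ u) (huv : u ≤ v) (hv : v ≤ 1) {a b : ℝ}
    (hab : a ≤ b) {c : ℝ} (hc : 1 ≤ |c|) :
    ∫ x in a..b, arc u v (c * x) ≤ (b - a + 1) * (v - u) := by
  have hc0 : 0 < |c| := by linarith
  have key : ∫ x in a..b, arc u v (c * x) ≤ |c|⁻¹ * ((|c| * (b - a) + 1) * (v - u)) := by
    rw [intervalIntegral.integral_comp_mul_left _ (abs_pos.1 hc0), smul_eq_mul]
    rcases le_total 0 c with h | h
    · rw [abs_of_nonneg h, mul_sub c]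
      exact mul_le_mul_of_nonneg_left
        (integral_arc_le hu huv hv (mul_le_mul_of_nonneg_left hab h)) (by positivity)
    · rw [abs_of_nonpos h, intervalIntegral.integral_symm, inv_neg, mul_neg, neg_mul]
      have h1 := integral_arc_le hu huv hv (mul_le_mul_of_nonpos_left hab h)
      have h2 := mul_le_mul_of_nonneg_left h1 (inv_nonneg.2 (neg_nonneg.2 h))
      rw [inv_neg, neg_mul, neg_mul] at h2
      refine h2.trans (le_of_eq ?_)
      ring
  refine key.trans ?_
  rw [inv_mul_le_iff₀ hc0]
  nlinarith [mul_nonneg (sub_nonneg.2 hc) (sub_nonneg.2 huv)]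

/-- Along the times `2 ^ (M j)`, almost every orbit visits the dyadic neighbourhoods of `z`
down to the scale `2 ^ (-(M + 1) j)` with controlled frequency, and avoids the smallest one. -/
theorem ae_eventually_dyadic {α : ℝ} (hα : 1 < |α|) {z : ℝ} (hz : z ∈ Icc (0 : ℝ) 1) {q : ℝ}
    (hq1 : 1 < q) {M : ℕ} (hM : q ^ (2 * (M + 1)) < 2 ^ M) :
    ∀ᵐ x : ℝ, ∀ᶠ j : ℕ in atTop,
      (∀ k ≤ (M + 1) * j, ∑ n ∈ Finset.range (2 ^ (M * j)),
        arc (dyadicLeft z k) (dyadicRight z k) (α ^ n * x) ≤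
          2 ^ (M * j) * (2 * (1 / 2) ^ k + q⁻¹ ^ k)) ∧
      ∀ n < 2 ^ (M * j), (1 / 2 : ℝ) ^ ((M + 1) * j) ≤ |Int.fract (α ^ n * x) - z| := by
  have hq0 : 0 < q := by linarith
  have hL := dyadicLeft_nonneg z
  have hLR := dyadicLeft_le_dyadicRight hz
  have hR := dyadicRight_le_one z
  -- frequencies
  have hae1 : ∀ᵐ x : ℝ, Tendsto (fun j : ℕ => ∑ k ∈ Finset.range ((M + 1) * j + 1),
      (q ^ k / 2 ^ (M * j)) ^ 2 *
        arcSum α (dyadicLeft z k) (dyadicRight z k) (2 ^ (M * j)) x ^ 2) atTop (𝓝 0) := by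
    have hii : ∀ (j k : ℕ) (a b : ℝ), IntervalIntegrable (fun x => (q ^ k / 2 ^ (M * j)) ^ 2 *
        arcSum α (dyadicLeft z k) (dyadicRight z k) (2 ^ (M * j)) x ^ 2) volume a b :=
      fun j k a b => (intervalIntegrable_arcSum_sq (hL k) (hLR k) (hR k) _ a b).const_mul _
    refine ae_tendsto_zero_of_summable_integral
      (fun j x => Finset.sum_nonneg fun k _ => by positivity)
      (fun j a b => ?_) fun R => ?_
    · have := IntervalIntegrable.sum (Finset.range ((M + 1) * j + 1)) fun k _ => hii j k a b
      simpa only [Finset.sum_fn] using this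
    · have hRR : (-R : ℝ) ≤ R := by linarith [(Nat.cast_nonneg R : (0 : ℝ) ≤ R)]
      set K : ℝ := (R - (-R) + 3) * (2 * (1 - |α|⁻¹)⁻¹ + 1) with hK
      have hK0 : 0 ≤ K := by
        have : |α|⁻¹ < 1 := inv_lt_one_of_one_lt₀ hα
        have : 0 ≤ (1 - |α|⁻¹)⁻¹ := inv_nonneg.2 (by linarith)
        exact mul_nonneg (by linarith) (by linarith)
      have hr : q ^ (2 * (M + 1)) / 2 ^ M < 1 := (div_lt_one (by positivity)).2 hM
      have hQ : 0 < q ^ 2 - 1 := by nlinarith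
      -- Scale k costs K q^{2k} / 2^{Mj}; the geometric sum over k ≤ (M+1)j is comparable to its
      -- last term, and `hM` makes the result summable in j.
      refine ⟨fun j => (K * (q ^ 2 / (q ^ 2 - 1))) * (q ^ (2 * (M + 1)) / 2 ^ M) ^ j,
        (summable_geometric_of_lt_one (by positivity) hr).mul_left _, fun j => ?_⟩
      rw [intervalIntegral.integral_finsetSum fun k _ => hii j k _ _]
      have h1 : ∀ k : ℕ, ∫ x in (-R : ℝ)..R, (q ^ k / 2 ^ (M * j)) ^ 2 *
          arcSum α (dyadicLeft z k) (dyadicRight z k) (2 ^ (M * j)) x ^ 2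
          ≤ (K / 2 ^ (M * j)) * (q ^ 2) ^ k := by
        intro k
        rw [intervalIntegral.integral_const_mul]
        refine (mul_le_mul_of_nonneg_left (integral_arcSum_sq_le hα (hL k) (hLR k) (hR k) hRR _)
          (by positivity)).trans (le_of_eq ?_)
        rw [← hK]
        push_cast
        have : (2 : ℝ) ^ (M * j) ≠ 0 := by positivity
        field_simp
        rw [← pow_mul, ← pow_mul, mul_comm k 2, mul_comm]
      refine (Finset.sum_le_sum fun k _ => h1 k).trans ?_
      rw [← Finset.mul_sum, geom_sum_eq (by linarith)]
      have h2 : ((q ^ 2) ^ ((M + 1) * j + 1) - 1) / (q ^ 2 - 1)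
          ≤ (q ^ 2) ^ ((M + 1) * j + 1) / (q ^ 2 - 1) := by
        gcongr
        linarith
      refine (mul_le_mul_of_nonneg_left h2 (by positivity)).trans (le_of_eq ?_)
      have h3 : (q ^ 2) ^ ((M + 1) * j + 1) = q ^ 2 * (q ^ (2 * (M + 1))) ^ j := by
        rw [← pow_mul, ← pow_mul, ← pow_add]
        congr 1
        ring
      rw [h3]
      beta_reduce
      rw [div_pow, ← pow_mul 2 M j]
      ring
  -- avoidance
  have hae2 : ∀ᵐ x : ℝ, Tendsto (fun j : ℕ => ∑ n ∈ Finset.range (2 ^ (M * j)),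
      arc (dyadicLeft z ((M + 1) * j)) (dyadicRight z ((M + 1) * j)) (α ^ n * x))
      atTop (𝓝 0) := by
    have hii : ∀ (u v c a b : ℝ), IntervalIntegrable (fun x => arc u v (c * x)) volume a b :=
      fun u v c a b => intervalIntegrable_of_abs_le (M := 1)
        ((measurable_arc u v).comp (measurable_const_mul c))
        (fun y => abs_le.2 ⟨neg_one_lt_zero.le.trans (arc_nonneg u v _), arc_le_one u v _⟩) _ _
    refine ae_tendsto_zero_of_summable_integral
      (fun j x => Finset.sum_nonneg fun k _ => arc_nonneg _ _ _)
      (fun j a b => ?_) fun R => ?_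
    · have := IntervalIntegrable.sum (Finset.range (2 ^ (M * j))) fun n _ =>
        hii (dyadicLeft z ((M + 1) * j)) (dyadicRight z ((M + 1) * j)) (α ^ n) a b
      simpa only [Finset.sum_fn] using this
    · have hRR : (-R : ℝ) ≤ R := by linarith [(Nat.cast_nonneg R : (0 : ℝ) ≤ R)]
      -- First moment: 2^{Mj} times an arc of length at most 2·2^{-(M+1)j} leaves a multiple of 2⁻ʲ.
      refine ⟨fun j => ((R - (-R) + 1) * 2) * (1 / 2) ^ j, summable_geometric_two.mul_left _,
        fun j => ?_⟩
      rw [intervalIntegral.integral_finsetSum fun n _ => hii _ _ _ _ _]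
      refine (Finset.sum_le_sum fun n _ => (integral_arc_comp_mul_le (hL _) (hLR _) (hR _) hRR
        (c := α ^ n) (by rw [abs_pow]; exact one_le_pow₀ hα.le)).trans
          (mul_le_mul_of_nonneg_left (dyadicRight_sub_dyadicLeft_le z _) (by linarith))).trans
          (le_of_eq ?_)
      rw [Finset.sum_const, Finset.card_range, nsmul_eq_mul]
      have h1 : (1 / 2 : ℝ) ^ ((M + 1) * j) = (1 / 2) ^ (M * j) * (1 / 2) ^ j := by
        rw [← pow_add]
        congr 1
        ring
      have h2 : (2 : ℝ) ^ (M * j) * (1 / 2) ^ (M * j) = 1 := by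
        rw [← mul_pow]
        norm_num
      rw [h1]
      push_cast
      linear_combination (R - (-R) + 1 : ℝ) * 2 * (1 / 2) ^ j * h2
  filter_upwards [hae1, hae2] with x hx1 hx2
  -- The threshold 1 serves twice: every weighted square is below 1, and a visit count below 1 is
  -- zero.
  filter_upwards [hx1.eventually_lt_const one_pos, hx2.eventually_lt_const one_pos] with j h1 h2
  refine ⟨fun k hk => ?_, fun n hn => ?_⟩
  · have h3 := (Finset.single_le_sum (f := fun k => (q ^ k / 2 ^ (M * j)) ^ 2 *
      arcSum α (dyadicLeft z k) (dyadicRight z k) (2 ^ (M * j)) x ^ 2)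
      (fun k _ => by positivity) (Finset.mem_range.2 (Nat.lt_succ_of_le hk))).trans_lt h1
    rw [← mul_pow, sq_lt_one_iff_abs_lt_one] at h3
    have h4 := (le_abs_self _).trans h3.le
    have h5 : arcSum α (dyadicLeft z k) (dyadicRight z k) (2 ^ (M * j)) x
        ≤ 2 ^ (M * j) * q⁻¹ ^ k := by
      rw [div_mul_eq_mul_div, div_le_one (by positivity)] at h4
      rw [inv_pow, ← div_eq_mul_inv, le_div_iff₀' (by positivity)]
      exact h4
    rw [sum_arc_eq]
    have h6 := mul_le_mul_of_nonneg_left (dyadicRight_sub_dyadicLeft_le z k)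
      (show (0 : ℝ) ≤ 2 ^ (M * j) by positivity)
    push_cast
    linarith
  · by_contra! hlt
    have h3 := mem_dyadic ⟨Int.fract_nonneg _, Int.fract_lt_one _⟩ hlt
    have h4 := (Finset.single_le_sum (f := fun n => arc (dyadicLeft z ((M + 1) * j))
      (dyadicRight z ((M + 1) * j)) (α ^ n * x)) (fun k _ => arc_nonneg _ _ _)
      (Finset.mem_range.2 hn)).trans_lt h2
    rw [arc_of_mem h3] at h4
    exact lt_irrefl _ h4

/-! ### The contribution of a neighbourhood of a singularity -/

theorem exists_dyadic_scale {t : ℝ} {k K : ℕ} (h1 : t < (1 / 2) ^ k) (h2 : (1 / 2) ^ K ≤ t) :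
    ∃ l ∈ Finset.Ico k K, (1 / 2) ^ (l + 1) ≤ t ∧ t < (1 / 2) ^ l := by
  classical
  have hex : ∃ m, (1 / 2 : ℝ) ^ m ≤ t := ⟨K, h2⟩
  have hm := Nat.find_spec hex
  have hkm : k < Nat.find hex := by
    by_contra! hle
    have : (1 / 2 : ℝ) ^ k ≤ (1 / 2) ^ Nat.find hex :=
      pow_le_pow_of_le_one (by norm_num) (by norm_num) hle
    linarith
  have hmK : Nat.find hex ≤ K := Nat.find_min' hex h2
  refine ⟨Nat.find hex - 1, Finset.mem_Ico.2 ⟨by omega, by omega⟩, ?_, ?_⟩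
  · rwa [Nat.sub_add_cancel (by omega)]
  · exact not_le.1 (Nat.find_min hex (m := Nat.find hex - 1) (by omega))

/-- The gap q² < 2 is split: r > q makes the sum over shells converge, and r² < 2 makes the moments
summable for large M, since (r²/2)ᴹ falls below r⁻². -/
theorem exists_between_sq_lt_two {q : ℝ} (hq1 : 1 ≤ q) (hq2 : q ^ 2 < 2) :
    ∃ r : ℝ, q < r ∧ r < 2 ∧ ∃ M : ℕ, 0 < M ∧ r ^ (2 * (M + 1)) < 2 ^ M := by
  obtain ⟨r, hr⟩ : ∃ r : ℝ, r = √((q ^ 2 + 2) / 2) := ⟨_, rfl⟩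
  have hr2 : r ^ 2 = (q ^ 2 + 2) / 2 := by
    rw [hr, Real.sq_sqrt (by positivity)]
  have hqr : q < r := by
    rw [hr, Real.lt_sqrt (by linarith)]
    linarith
  have hrpos : 0 < r ^ 2 := by nlinarith
  refine ⟨r, hqr, by nlinarith, ?_⟩
  obtain ⟨M, hM⟩ := exists_pow_lt_of_lt_one (x := 1 / r ^ 2) (y := r ^ 2 / 2) (by positivity)
    (by linarith)
  have hlt : r ^ (2 * (M + 1)) < 2 ^ M := by
    rw [div_pow, div_lt_div_iff₀ (by positivity) hrpos, one_mul] at hM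
    rw [pow_mul, pow_succ]
    exact hM
  refine ⟨M, Nat.pos_of_ne_zero ?_, hlt⟩
  rintro rfl
  simp only [zero_add, mul_one, pow_zero] at hlt
  nlinarith

/-- Each visit lies in a shell k₀ ≤ k < K, because `havoid` excludes smaller distances. Shell k
contributes at most N·C·qᵏ·3r⁻ᵏ, using 2⁻ᵏ ≤ r⁻ᵏ. -/
theorem sum_near_le {α z x q r C : ℝ} (hq1 : 1 ≤ q) (hqr : q < r) (hr2 : r < 2) (hC : 0 ≤ C)
    {h : ℝ → ℝ} {k₁ k₀ K N : ℕ} (hk : k₁ ≤ k₀)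
    (hh : ∀ k ≥ k₁, ∀ y, (1 / 2) ^ (k + 1) ≤ |y - z| → |y - z| < (1 / 2) ^ k → h y ≤ C * q ^ k)
    (hfreq : ∀ k ≤ K, ∑ n ∈ Finset.range N,
        arc (dyadicLeft z k) (dyadicRight z k) (α ^ n * x) ≤ N * (2 * (1 / 2) ^ k + r⁻¹ ^ k))
    (havoid : ∀ n < N, (1 / 2 : ℝ) ^ K ≤ |Int.fract (α ^ n * x) - z|) :
    ∑ n ∈ Finset.range N, {y | |y - z| < (1 / 2) ^ k₀}.indicator h (Int.fract (α ^ n * x))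
      ≤ N * (3 * C * ((q / r) ^ k₀ / (1 - q / r))) := by
  have hr0 : 0 < r := by linarith
  have hq0 : 0 < q := by linarith
  have hterm : ∀ n ∈ Finset.range N,
      {y | |y - z| < (1 / 2) ^ k₀}.indicator h (Int.fract (α ^ n * x))
        ≤ ∑ k ∈ Finset.Ico k₀ K, C * q ^ k *
          arc (dyadicLeft z k) (dyadicRight z k) (α ^ n * x) := by
    intro n hn
    have hnn : ∀ k ∈ Finset.Ico k₀ K,
        0 ≤ C * q ^ k * arc (dyadicLeft z k) (dyadicRight z k) (α ^ n * x) := fun k _ =>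
      mul_nonneg (by positivity) (arc_nonneg _ _ _)
    by_cases hy : Int.fract (α ^ n * x) ∈ {y | |y - z| < (1 / 2) ^ k₀}
    · rw [indicator_of_mem hy]
      obtain ⟨k, hkI, hk1, hk2⟩ := exists_dyadic_scale hy (havoid n (Finset.mem_range.1 hn))
      refine le_trans ?_ (Finset.single_le_sum hnn hkI)
      rw [arc_of_mem (mem_dyadic ⟨Int.fract_nonneg _, Int.fract_lt_one _⟩ hk2), mul_one]
      exact hh k (hk.trans (Finset.mem_Ico.1 hkI).1) _ hk1 hk2
    · rw [indicator_of_notMem hy]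
      exact Finset.sum_nonneg hnn
  refine (Finset.sum_le_sum hterm).trans ?_
  rw [Finset.sum_comm]
  have hscale : ∀ k ∈ Finset.Ico k₀ K, ∑ n ∈ Finset.range N,
      C * q ^ k * arc (dyadicLeft z k) (dyadicRight z k) (α ^ n * x)
        ≤ N * (3 * C) * (q / r) ^ k := by
    intro k hkI
    rw [← Finset.mul_sum]
    refine (mul_le_mul_of_nonneg_left (hfreq k (Finset.mem_Ico.1 hkI).2.le)
      (by positivity)).trans ?_
    have h1 : (1 / 2 : ℝ) ^ k ≤ r⁻¹ ^ k := by
      rw [one_div]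
      gcongr
    have h2 : (q / r) ^ k = q ^ k * r⁻¹ ^ k := by rw [div_eq_mul_inv, mul_pow]
    rw [h2]
    have h3 : C * q ^ k * (N * (2 * (1 / 2) ^ k + r⁻¹ ^ k))
        ≤ C * q ^ k * (N * (3 * r⁻¹ ^ k)) := by
      gcongr
      linarith
    refine h3.trans (le_of_eq (by ring))
  refine (Finset.sum_le_sum hscale).trans ?_
  rw [← Finset.mul_sum, mul_assoc]
  gcongr
  exact geom_sum_Ico_le_of_lt_one (by positivity) ((div_lt_one hr0).2 hqr)

theorem ae_exists_radius {α : ℝ} (hα : 1 < |α|) {z : ℝ} (hz : z ∈ Icc (0 : ℝ) 1) {q C : ℝ}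
    (hq1 : 1 ≤ q) (hq2 : q ^ 2 < 2) (hC : 0 ≤ C) {h : ℝ → ℝ} (h0 : ∀ y, 0 ≤ h y) {k₁ : ℕ}
    (hh : ∀ k ≥ k₁, ∀ y, (1 / 2) ^ (k + 1) ≤ |y - z| → |y - z| < (1 / 2) ^ k →
      h y ≤ C * q ^ k) :
    ∀ᵐ x : ℝ, ∀ ε > 0, ∃ ρ > 0, ∀ᶠ N : ℕ in atTop,
      ∑ n ∈ Finset.range N, {y | |y - z| < ρ}.indicator h (Int.fract (α ^ n * x)) ≤ N * ε := by
  obtain ⟨r, hqr, hr2, M, hM0, hM⟩ := exists_between_sq_lt_two hq1 hq2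
  have hr0 : 0 < r := by linarith
  have hθ1 : q / r < 1 := (div_lt_one hr0).2 hqr
  have hθ0 : 0 ≤ q / r := div_nonneg (by linarith) hr0.le
  filter_upwards [ae_eventually_dyadic hα hz (by linarith) hM] with x hx ε hε
  -- The factor 2ᴹ pays for enlarging N to the next power of 2ᴹ, where the frequency bounds hold;
  -- nonnegativity of `h` permits the enlargement.
  have hlim : Tendsto (fun k : ℕ => 2 ^ M * (3 * C * ((q / r) ^ k / (1 - q / r)))) atTop
      (𝓝 0) := by
    have := (((tendsto_pow_atTop_nhds_zero_of_lt_one hθ0 hθ1).div_const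
      (1 - q / r)).const_mul (3 * C)).const_mul (2 ^ M)
    simpa using this
  obtain ⟨k₀, hk₀, hk₁⟩ := ((hlim.eventually_lt_const hε).and (eventually_ge_atTop k₁)).exists
  refine ⟨(1 / 2) ^ k₀, by positivity, ?_⟩
  obtain ⟨J, hJ⟩ := eventually_atTop.1 hx
  have hb : 1 < 2 ^ M := Nat.one_lt_two_pow hM0.ne'
  filter_upwards [eventually_ge_atTop ((2 ^ M) ^ J), eventually_ge_atTop 1] with N hN hN1
  have hlog : J ≤ Nat.log (2 ^ M) N := Nat.le_log_of_pow_le hb hN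
  have hlow : (2 ^ M) ^ Nat.log (2 ^ M) N ≤ N := Nat.pow_log_le_self _ (by omega)
  have hup : N ≤ 2 ^ (M * (Nat.log (2 ^ M) N + 1)) := by
    rw [pow_mul]
    exact (Nat.lt_pow_succ_log_self hb N).le
  obtain ⟨hfreq, havoid⟩ := hJ (Nat.log (2 ^ M) N + 1) (by omega)
  have hsum := sum_near_le (N := 2 ^ (M * (Nat.log (2 ^ M) N + 1))) hq1 hqr hr2 hC hk₁ hh
    (by push_cast; exact hfreq) havoid
  refine (Finset.sum_le_sum_of_subset_of_nonneg (Finset.range_subset_range.2 hup)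
    fun _ _ _ => indicator_nonneg (fun y _ => h0 y) _).trans (hsum.trans ?_)
  have hlow' : (((2 ^ M) ^ Nat.log (2 ^ M) N : ℕ) : ℝ) ≤ N := by exact_mod_cast hlow
  rw [mul_add, mul_one, pow_add, pow_mul]
  push_cast at hlow' ⊢
  rw [mul_assoc]
  have h1θ : 0 < 1 - q / r := by linarith
  exact mul_le_mul hlow' hk₀.le (by positivity) (by positivity)

/-! ### Growth at a singularity from the variation -/

theorem norm_sub_le_toReal_lintegral_deriv {f : ℝ → ℂ} {c d : ℝ}
    (hf : ∀ x ∈ Ioo c d, DifferentiableAt ℝ f x) {V : ℝ≥0∞} (hV : V ≠ ∞)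
    (hle : ∫⁻ x in Ioo c d, ‖deriv f x‖ₑ ≤ V) {x y : ℝ} (hx : x ∈ Ioo c d) (hy : y ∈ Ioo c d) :
    ‖f y - f x‖ ≤ V.toReal := by
  have hsub : uIcc x y ⊆ Ioo c d := OrdConnected.uIcc_subset ordConnected_Ioo hx hy
  have hint : IntegrableOn (deriv f) (Ioo c d) :=
    ⟨(measurable_deriv f).aestronglyMeasurable, hle.trans_lt hV.lt_top⟩
  have hint' : IntervalIntegrable (deriv f) volume x y :=
    (hint.mono_set hsub).intervalIntegrable
  rw [← intervalIntegral.integral_deriv_eq_sub (fun t ht => hf t (hsub ht)) hint']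
  refine intervalIntegral.norm_integral_le_integral_norm_uIoc.trans ?_
  rw [integral_norm_eq_lintegral_enorm (measurable_deriv f).aestronglyMeasurable]
  exact ENNReal.toReal_mono hV
    ((lintegral_mono_set (uIoc_subset_uIcc.trans hsub)).trans hle)

/-- Integrate f' from the fixed point z ± δ/2 to y. The variation at N = 2^{k+2} bounds the change
by N^β with β < 1/2, so q = 2^β. -/
theorem exists_growth_of_variation {f : ℝ → ℂ} {z δ η : ℝ} (hδ : 0 < δ)
    (hf : DifferentiableOn ℝ f (Ioo (z - δ) (z + δ) \ {z})) (hη : 0 < η)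
    (hV : ∀ᶠ N : ℕ in atTop, V f z δ 1 N ≠ ∞)
    (hVo : (fun N : ℕ => (V f z δ 1 N).toReal) =o[atTop]
      (fun N : ℕ => (N : ℝ) ^ ((1 : ℝ) / 2 - η))) :
    ∃ q C : ℝ, 1 ≤ q ∧ q ^ 2 < 2 ∧ 0 ≤ C ∧ ∃ k₁ : ℕ, ∀ k ≥ k₁, ∀ y,
      (1 / 2) ^ (k + 1) ≤ |y - z| → |y - z| < (1 / 2) ^ k → ‖f y‖ ≤ C * q ^ k := by
  -- Capping η at 1/4 keeps β nonnegative, hence q ≥ 1.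
  obtain ⟨β, hβ⟩ : ∃ β : ℝ, β = 1 / 2 - min η (1 / 4) := ⟨_, rfl⟩
  have hm1 : min η (1 / 4) ≤ 1 / 4 := min_le_right _ _
  have hm2 : min η (1 / 4) ≤ η := min_le_left _ _
  have hm3 : 0 < min η (1 / 4) := lt_min hη (by norm_num)
  have hβ0 : 0 ≤ β := by linarith
  have hβ2 : β * 2 < 1 := by linarith
  obtain ⟨q, hq⟩ : ∃ q : ℝ, q = 2 ^ β := ⟨_, rfl⟩
  have hq1 : 1 ≤ q := by
    rw [hq]
    exact Real.one_le_rpow (by norm_num) hβ0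
  have hq2 : q ^ 2 < 2 := by
    rw [hq, ← Real.rpow_natCast, ← Real.rpow_mul (by norm_num)]
    calc (2 : ℝ) ^ (β * (2 : ℕ)) < 2 ^ (1 : ℝ) :=
          Real.rpow_lt_rpow_of_exponent_lt (by norm_num) (by exact_mod_cast hβ2)
      _ = 2 := Real.rpow_one 2
  have hdiff : ∀ x ∈ Ioo (z - δ) (z + δ), x ≠ z → DifferentiableAt ℝ f x := fun x hx hxz =>
    hf.differentiableAt ((isOpen_Ioo.sdiff isClosed_singleton).mem_nhds ⟨hx, hxz⟩)
  have hev : ∀ᶠ N : ℕ in atTop, V f z δ 1 N ≠ ∞ ∧ (V f z δ 1 N).toReal ≤ (N : ℝ) ^ β := by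
    filter_upwards [hV, hVo.bound one_pos, eventually_ge_atTop 1] with N h1 h2 h3
    refine ⟨h1, ?_⟩
    rw [one_mul, Real.norm_of_nonneg ENNReal.toReal_nonneg,
      Real.norm_of_nonneg (by positivity)] at h2
    exact h2.trans (Real.rpow_le_rpow_of_exponent_le (by exact_mod_cast h3) (by linarith))
  -- The exponent k + 2 puts the cutoff strictly below 2^{-(k+1)}, so the whole shell lies in the
  -- open domain of integration; the extra factor q² is below 2.
  have hev2 : ∀ᶠ k : ℕ in atTop, V f z δ 1 (2 ^ (k + 2)) ≠ ∞ ∧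
      (V f z δ 1 (2 ^ (k + 2))).toReal ≤ ((2 ^ (k + 2) : ℕ) : ℝ) ^ β :=
    ((tendsto_pow_atTop_atTop_of_one_lt one_lt_two).comp
      (tendsto_add_atTop_nat 2)).eventually hev
  have hev3 : ∀ᶠ k : ℕ in atTop, (1 / 2 : ℝ) ^ k < δ / 2 :=
    (tendsto_pow_atTop_nhds_zero_of_lt_one (by norm_num) (by norm_num)).eventually_lt_const
      (half_pos hδ)
  obtain ⟨k₁, hk₁⟩ := eventually_atTop.1 (hev2.and hev3)
  obtain ⟨A, hA⟩ : ∃ A : ℝ, A = ‖f (z + δ / 2)‖ + ‖f (z - δ / 2)‖ := ⟨_, rfl⟩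
  have hA1 : ‖f (z + δ / 2)‖ ≤ A := by linarith [norm_nonneg (f (z - δ / 2))]
  have hA2 : ‖f (z - δ / 2)‖ ≤ A := by linarith [norm_nonneg (f (z + δ / 2))]
  have hA0 : 0 ≤ A := (norm_nonneg _).trans hA1
  refine ⟨q, A + 2, hq1, hq2, by linarith, k₁, fun k hk y hy1 hy2 => ?_⟩
  obtain ⟨⟨hVk, hVle⟩, hkδ⟩ := hk₁ k hk
  have hqk : 1 ≤ q ^ k := one_le_pow₀ hq1
  have hVq : (V f z δ 1 (2 ^ (k + 2))).toReal ≤ 2 * q ^ k := by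
    refine hVle.trans ?_
    have h1 : (((2 ^ (k + 2) : ℕ) : ℝ)) ^ β = q ^ (k + 2) := by
      push_cast
      rw [hq, ← Real.rpow_natCast, ← Real.rpow_mul (by norm_num), mul_comm,
        Real.rpow_mul (by norm_num), Real.rpow_natCast]
    rw [h1, pow_add]
    nlinarith
  have hr : 1 / ((2 ^ (k + 2) : ℕ) : ℝ) ^ (1 : ℝ) = (1 / 2) ^ (k + 2) := by
    rw [Real.rpow_one]
    push_cast
    rw [one_div_pow]
  have hrlt : (1 / 2 : ℝ) ^ (k + 2) < (1 / 2) ^ (k + 1) :=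
    pow_lt_pow_right_of_lt_one₀ (by norm_num) (by norm_num) (by omega)
  have hrk : (1 / 2 : ℝ) ^ (k + 1) ≤ (1 / 2) ^ k :=
    pow_le_pow_of_le_one (by norm_num) (by norm_num) (by omega)
  have hrpos : (0 : ℝ) < (1 / 2) ^ (k + 2) := by positivity
  have hfin : ∀ w, ‖f w‖ ≤ A → ‖f y - f w‖ ≤ (V f z δ 1 (2 ^ (k + 2))).toReal →
      ‖f y‖ ≤ (A + 2) * q ^ k := by
    intro w hw hyw
    have h1 := norm_le_norm_add_norm_sub (f w) (f y)
    rw [norm_sub_rev] at hyw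
    rw [norm_sub_rev] at h1
    nlinarith [norm_sub_rev (f w) (f y)]
  rcases le_total z y with hzy | hzy
  · rw [abs_of_nonneg (sub_nonneg.2 hzy)] at hy1 hy2
    refine hfin _ hA1 (norm_sub_le_toReal_lintegral_deriv
      (c := z + 1 / ((2 ^ (k + 2) : ℕ) : ℝ) ^ (1 : ℝ)) (d := z + δ) ?_ hVk
      (le_add_self.trans_eq rfl) ?_ ?_)
    · rw [hr]
      exact fun x hx => hdiff x ⟨by linarith [hx.1], hx.2⟩ (by linarith [hx.1] : z < x).ne'
    · rw [hr]
      constructor <;> linarith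
    · rw [hr]
      constructor <;> linarith
  · rw [abs_of_nonpos (sub_nonpos.2 hzy)] at hy1 hy2
    refine hfin _ hA2 (norm_sub_le_toReal_lintegral_deriv
      (c := z - δ) (d := z - 1 / ((2 ^ (k + 2) : ℕ) : ℝ) ^ (1 : ℝ)) ?_ hVk
      (le_self_add.trans_eq rfl) ?_ ?_)
    · rw [hr]
      exact fun x hx => hdiff x ⟨hx.1, by linarith [hx.2]⟩ (by linarith [hx.2] : x < z).ne
    · rw [hr]
      constructor <;> linarith
    · rw [hr]
      constructor <;> linarith

/-! ### Step functions on the uniform subdivision -/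

/-- The `1`-periodic step function with value `c i` on `[i / n, (i + 1) / n)` for `i < n`. -/
noncomputable def step {E : Type*} [AddCommGroup E] [Module ℝ E] (n : ℕ) (c : ℕ → E) (y : ℝ) : E :=
  ∑ i ∈ Finset.range n, arc ((i : ℝ) / n) (((i : ℝ) + 1) / n) y • c i

theorem exists_cell {n : ℕ} (hn : 0 < n) (y : ℝ) :
    ∃ i < n, Int.fract y ∈ Icc ((i : ℝ) / n) (((i : ℝ) + 1) / n) ∧
      ∀ j < n, arc ((j : ℝ) / n) (((j : ℝ) + 1) / n) y = if j = i then 1 else 0 := by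
  have hn0 : (0 : ℝ) < n := by exact_mod_cast hn
  have h0 := Int.fract_nonneg y
  have h1 := Int.fract_lt_one y
  have hpos : 0 ≤ n * Int.fract y := by positivity
  have hmem : ∀ j : ℕ, Int.fract y ∈ Ico ((j : ℝ) / n) (((j : ℝ) + 1) / n) ↔
      ⌊n * Int.fract y⌋₊ = j := by
    intro j
    rw [Nat.floor_eq_iff hpos, mem_Ico, div_le_iff₀' hn0, lt_div_iff₀' hn0]
  have hi := (hmem _).2 rfl
  refine ⟨⌊n * Int.fract y⌋₊, (Nat.floor_lt hpos).2 (by nlinarith), Ico_subset_Icc_self hi,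
    fun j _ => ?_⟩
  split_ifs with h
  · rw [h]
    exact arc_of_mem hi
  · rw [arc, indicator_of_notMem]
    rw [hmem]
    exact fun h' => h h'.symm

theorem cell_bounds {n i : ℕ} (hi : i < n) :
    0 ≤ (i : ℝ) / n ∧ (i : ℝ) / n ≤ ((i : ℝ) + 1) / n ∧ ((i : ℝ) + 1) / n ≤ 1 := by
  have hn : 0 < n := by omega
  have hn0 : (0 : ℝ) < n := by exact_mod_cast hn
  refine ⟨by positivity, (div_lt_succ_div hn i).le, ?_⟩
  rw [div_le_one hn0]
  exact_mod_cast hi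

theorem intervalIntegrable_arc_smul {E : Type*} [NormedAddCommGroup E] [NormedSpace ℝ E]
    (u v a b : ℝ) (c : E) : IntervalIntegrable (fun y => arc u v y • c) volume a b :=
  ⟨(intervalIntegrable_arc u v a b).1.smul_const c, (intervalIntegrable_arc u v a b).2.smul_const c⟩

theorem intervalIntegrable_step {E : Type*} [NormedAddCommGroup E] [NormedSpace ℝ E] (n : ℕ)
    (c : ℕ → E) (a b : ℝ) : IntervalIntegrable (step n c) volume a b := by
  have := IntervalIntegrable.sum (Finset.range n) (f := fun i y =>
    arc ((i : ℝ) / n) (((i : ℝ) + 1) / n) y • c i)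
    fun i _ => intervalIntegrable_arc_smul ((i : ℝ) / n) (((i : ℝ) + 1) / n) a b (c i)
  simp only [Finset.sum_fn] at this
  exact this

theorem integral_step {E : Type*} [NormedAddCommGroup E] [NormedSpace ℝ E] [CompleteSpace E]
    (n : ℕ) (c : ℕ → E) :
    ∫ y in (0 : ℝ)..1, step n c y = ∑ i ∈ Finset.range n, (1 / (n : ℝ)) • c i := by
  unfold step
  rw [intervalIntegral.integral_finsetSum fun (i : ℕ) _ =>
    intervalIntegrable_arc_smul ((i : ℝ) / n) (((i : ℝ) + 1) / n) 0 1 (c i)]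
  refine Finset.sum_congr rfl fun i hi => ?_
  obtain ⟨h1, h2, h3⟩ := cell_bounds (Finset.mem_range.1 hi)
  rw [intervalIntegral.integral_smul_const, integral_arc h1 h2 h3]
  congr 1
  ring

theorem tendsto_average_step {E : Type*} [NormedAddCommGroup E] [NormedSpace ℝ E] {n : ℕ}
    (c : ℕ → E) {w : ℕ → ℝ}
    (harc : ∀ i < n, Tendsto (fun N : ℕ =>
      (∑ m ∈ Finset.range N, arc ((i : ℝ) / n) (((i : ℝ) + 1) / n) (w m)) / N) atTop
        (𝓝 (1 / (n : ℝ)))) :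
    Tendsto (fun N : ℕ => (N : ℝ)⁻¹ • ∑ m ∈ Finset.range N, step n c (w m)) atTop
      (𝓝 (∑ i ∈ Finset.range n, (1 / (n : ℝ)) • c i)) := by
  have h := tendsto_finsetSum (Finset.range n) fun i hi =>
    (harc i (Finset.mem_range.1 hi)).smul_const (c i)
  refine h.congr fun N => ?_
  unfold step
  rw [Finset.sum_comm, Finset.smul_sum]
  refine Finset.sum_congr rfl fun i _ => ?_
  rw [← Finset.sum_smul, smul_smul, div_eq_inv_mul]

theorem fract_eq_of_periodic {f : ℝ → ℂ} (hf : Function.Periodic f 1) (y : ℝ) :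
    f (Int.fract y) = f y := by
  have := hf.sub_zsmul_eq (x := y) ⌊y⌋
  rwa [zsmul_eq_mul, mul_one] at this

/-- Away from S one has g = f, and the oscillation of g suffices. Near S, g vanishes, so the error
is at most ‖f‖ plus the oscillation. -/
theorem norm_sub_step_le {f : ℝ → ℂ} (hf : Function.Periodic f 1) {S : Finset ℝ} {ρ : ℝ}
    {n : ℕ} (hn : 0 < n) {o : ℕ → ℝ} {g : ℝ → ℂ}
    (hg : g = (Icc 0 1 \ ((S : Set ℝ) + Ioo (-ρ) ρ)).indicator f)
    (ho : ∀ i < n, ∀ x ∈ Icc ((i : ℝ) / n) (((i : ℝ) + 1) / n),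
      ∀ y ∈ Icc ((i : ℝ) / n) (((i : ℝ) + 1) / n), ‖g x - g y‖ ≤ o i) (y : ℝ) :
    ‖f y - step n (fun i => g (i / n)) y‖ ≤ step n o y +
      ∑ z ∈ S, {t | |t - z| < ρ}.indicator (fun t => ‖f t‖) (Int.fract y) := by
  obtain ⟨i, hi, hyi, harc⟩ := exists_cell hn y
  have hstep : ∀ {E : Type} [AddCommGroup E] [Module ℝ E] (c : ℕ → E), step n c y = c i := by
    intro E _ _ c
    rw [step, Finset.sum_eq_single i]
    · rw [harc i hi, if_pos rfl, one_smul]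
    · intro j hj hji
      rw [harc j (Finset.mem_range.1 hj), if_neg hji, zero_smul]
    · intro h
      exact absurd (Finset.mem_range.2 hi) h
  rw [hstep, hstep, ← fract_eq_of_periodic hf y]
  have hosc : ‖g (Int.fract y) - g (i / n)‖ ≤ o i :=
    ho i hi _ hyi _ ⟨le_rfl, (div_lt_succ_div hn i).le⟩
  have hnn : ∀ z ∈ S, 0 ≤ {t | |t - z| < ρ}.indicator (fun t => ‖f t‖) (Int.fract y) :=
    fun z _ => indicator_nonneg (fun t _ => norm_nonneg (f t)) _
  by_cases hA : Int.fract y ∈ (S : Set ℝ) + Ioo (-ρ) ρ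
  · obtain ⟨z, hz, s, hs, hzs⟩ := hA
    have hclose : Int.fract y ∈ {t | |t - z| < ρ} := by
      rw [mem_ofPred_eq, ← hzs, abs_lt]
      simp only [add_sub_cancel_left]
      exact hs
    have h0 : g (Int.fract y) = 0 := by
      rw [hg, indicator_of_notMem]
      exact fun h => h.2 ⟨z, hz, s, hs, hzs⟩
    have h1 := Finset.single_le_sum hnn (Finset.mem_coe.1 hz)
    rw [indicator_of_mem hclose] at h1
    rw [h0, zero_sub, norm_neg] at hosc
    exact (norm_sub_le _ _).trans (by linarith)
  · have h0 : g (Int.fract y) = f (Int.fract y) := by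
      rw [hg, indicator_of_mem]
      exact ⟨⟨Int.fract_nonneg y, (Int.fract_lt_one y).le⟩, hA⟩
    rw [h0] at hosc
    linarith [Finset.sum_nonneg hnn]

/-! ### Assembly -/

theorem eventually_integral_near_le {f : ℝ → ℂ} (hf : IntervalIntegrable f volume 0 1) (z : ℝ)
    {ε : ℝ} (hε : 0 < ε) :
    ∀ᶠ ρ in 𝓝[>] (0 : ℝ), ∫ y in Ioc (0 : ℝ) 1, {t | |t - z| < ρ}.indicator (fun t => ‖f t‖) y
      ≤ ε := by
  have hint : IntegrableOn (fun t => ‖f t‖) (Ioc 0 1) :=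
    ((intervalIntegrable_iff_integrableOn_Ioc_of_le zero_le_one).1 hf).norm
  have hmeas : ∀ ρ : ℝ, MeasurableSet {t : ℝ | |t - z| < ρ} := fun ρ =>
    measurableSet_lt (by fun_prop) measurable_const
  have hanti : Antitone fun k : ℕ => {t : ℝ | |t - z| < 1 / ((k : ℝ) + 1)} := by
    intro k l hkl t ht
    rw [mem_ofPred_eq] at ht ⊢
    exact ht.trans_le (Nat.one_div_le_one_div hkl)
  have hinter : ⋂ k : ℕ, {t : ℝ | |t - z| < 1 / ((k : ℝ) + 1)} = {z} := by
    ext t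
    simp only [mem_iInter, mem_ofPred_eq, mem_singleton_iff]
    constructor
    · intro h
      by_contra hne
      obtain ⟨k, hk⟩ := exists_nat_one_div_lt (abs_pos.2 (sub_ne_zero.2 hne))
      exact lt_asymm hk (h k)
    · rintro rfl k
      rw [sub_self, abs_zero]
      positivity
  have hlim := tendsto_setIntegral_of_antitone (μ := volume.restrict (Ioc (0 : ℝ) 1))
    (f := fun t => ‖f t‖) (fun k : ℕ => hmeas (1 / ((k : ℝ) + 1))) hanti
    ⟨0, hint.integrableOn⟩
  rw [hinter, Measure.restrict_restrict (measurableSet_singleton z),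
    setIntegral_measure_zero _ (measure_mono_null inter_subset_left (measure_singleton z))] at hlim
  obtain ⟨k, hk⟩ := (hlim.eventually_lt_const hε).exists
  filter_upwards [Ioo_mem_nhdsGT (show (0 : ℝ) < 1 / ((k : ℝ) + 1) by positivity)] with ρ hρ
  refine le_trans ?_ hk.le
  rw [integral_indicator (hmeas ρ)]
  refine setIntegral_mono_set hint.integrableOn (ae_of_all _ fun t => norm_nonneg _) ?_
  exact (show {t : ℝ | |t - z| < ρ} ⊆ {t | |t - z| < 1 / ((k : ℝ) + 1)} from
    fun t ht => lt_trans ht hρ.2).eventuallyLE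

/-- Both the averages and the integral are compared with one Riemann sum G of the truncated
function. The averages cost (3 + |S|)ε and the integral (1 + |S|)ε. -/
theorem tendsto_average_of_orbit {f : ℝ → ℂ} (hf : Function.Periodic f 1)
    (hfi : IntervalIntegrable f volume 0 1) {S : Finset ℝ}
    (hriem : ∀ δ : ℝ, 0 < δ →
      RiemannIntegrableOn f (Icc 0 1 \ ((S : Set ℝ) + Ioo (-δ) δ)) 0 1) {w : ℕ → ℝ}
    (harc : ∀ n : ℕ, ∀ i < n, Tendsto (fun N : ℕ =>
      (∑ m ∈ Finset.range N, arc ((i : ℝ) / n) (((i : ℝ) + 1) / n) (w m)) / N) atTop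
        (𝓝 (1 / (n : ℝ))))
    (hnear : ∀ z ∈ S, ∀ ε > 0, ∃ ρ > 0, ∀ᶠ N : ℕ in atTop,
      ∑ m ∈ Finset.range N, {y | |y - z| < ρ}.indicator (fun t => ‖f t‖) (Int.fract (w m))
        ≤ N * ε) :
    Tendsto (fun N : ℕ => (N : ℝ)⁻¹ • ∑ m ∈ Finset.range N, f (w m)) atTop
      (𝓝 (∫ y in (0 : ℝ)..1, f y)) := by
  have main : ∀ ε > 0, ∀ᶠ N : ℕ in atTop,
      ‖(N : ℝ)⁻¹ • ∑ m ∈ Finset.range N, f (w m) - ∫ y in (0 : ℝ)..1, f y‖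
        ≤ (4 + 2 * S.card) * ε := by
    intro ε hε
    -- The bound persists for smaller radii, so one ρ can serve all of S, for the averages and the
    -- integrals alike.
    have hρ1 : ∀ z ∈ S, ∀ᶠ ρ in 𝓝[>] (0 : ℝ), ∀ᶠ N : ℕ in atTop, ∑ m ∈ Finset.range N,
        {y | |y - z| < ρ}.indicator (fun t => ‖f t‖) (Int.fract (w m)) ≤ N * ε := by
      intro z hz
      obtain ⟨ρ₀, hρ₀, h⟩ := hnear z hz ε hε
      filter_upwards [Ioo_mem_nhdsGT hρ₀] with ρ hρ
      filter_upwards [h] with N hN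
      refine (Finset.sum_le_sum fun m _ => ?_).trans hN
      exact indicator_le_indicator_of_subset (fun t ht => lt_trans ht hρ.2)
        (fun t => norm_nonneg _) _
    obtain ⟨ρ, hρ, hρpos⟩ := (((Filter.eventually_all_finset S).2 fun z hz =>
      (hρ1 z hz).and (eventually_integral_near_le hfi z hε)).and self_mem_nhdsWithin).exists
    obtain ⟨g, hg⟩ : ∃ g, g = (Icc 0 1 \ ((S : Set ℝ) + Ioo (-ρ) ρ)).indicator f := ⟨_, rfl⟩
    have hgr : RiemannIntegrableIcc g 0 1 := hg ▸ hriem ρ hρpos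
    obtain ⟨n, hn, o, ho, hosum⟩ := hgr.exists_oscillation_bound hε
    have hn0 : (0 : ℝ) < n := by exact_mod_cast hn
    have hpt := norm_sub_step_le hf hn hg ho
    have hoε : ∑ i ∈ Finset.range n, (1 / (n : ℝ)) • o i ≤ ε := by
      rw [← Finset.smul_sum, smul_eq_mul, one_div, inv_mul_le_iff₀ hn0]
      exact hosum
    obtain ⟨G, hG⟩ : ∃ G : ℂ, G = ∑ i ∈ Finset.range n, (1 / (n : ℝ)) • g (i / n) := ⟨_, rfl⟩
    -- the integral is close to the Riemann sum
    have hIG : ‖(∫ y in (0 : ℝ)..1, f y) - G‖ ≤ ε + S.card * ε := by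
      have hindint : ∀ z ∈ S, IntervalIntegrable
          ({t | |t - z| < ρ}.indicator (fun t => ‖f t‖)) volume 0 1 := by
        intro z _
        rw [intervalIntegrable_iff_integrableOn_Ioc_of_le zero_le_one] at hfi ⊢
        exact hfi.norm.indicator (measurableSet_lt (by fun_prop) measurable_const)
      have hsumint : IntervalIntegrable (fun y => ∑ z ∈ S,
          {t | |t - z| < ρ}.indicator (fun t => ‖f t‖) y) volume 0 1 := by
        have := IntervalIntegrable.sum S hindint
        simpa only [Finset.sum_fn] using this
      rw [hG, ← integral_step n (fun i => g (i / n)),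
        ← intervalIntegral.integral_sub hfi (intervalIntegrable_step n _ 0 1)]
      have hle := intervalIntegral.norm_integral_le_of_norm_le (a := 0) (b := 1) (μ := volume)
        (f := fun y => f y - step n (fun i => g (i / n)) y)
        (g := fun y => step n o y + ∑ z ∈ S,
          {t | |t - z| < ρ}.indicator (fun t => ‖f t‖) y) zero_le_one ?_
        ((intervalIntegrable_step n o 0 1).add hsumint)
      · refine hle.trans ?_
        rw [intervalIntegral.integral_add (intervalIntegrable_step n o 0 1) hsumint,
          integral_step, intervalIntegral.integral_finsetSum hindint]
        refine add_le_add hoε ?_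
        rw [← nsmul_eq_mul]
        refine Finset.sum_le_card_nsmul _ _ _ fun z hz => ?_
        rw [intervalIntegral.integral_of_le zero_le_one]
        exact (hρ z hz).2
      -- At y = 1 the fractional part jumps to 0, so this point is discarded.
      · have hne : ∀ᵐ y : ℝ, y ≠ 1 := by
          simp [ae_iff, measure_singleton]
        filter_upwards [hne] with y hy1 hy
        have hfr : Int.fract y = y :=
          Int.fract_eq_self.2 ⟨hy.1.le, lt_of_le_of_ne hy.2 hy1⟩
        have := hpt y
        rwa [hfr] at this
    -- the averages are close to those of the step function
    have hlimG := tendsto_average_step (fun i => g (i / n)) (harc n)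
    rw [← hG] at hlimG
    have hlimo := tendsto_average_step o (harc n)
    have hev1 := (tendsto_iff_norm_sub_tendsto_zero.1 hlimG).eventually_lt_const hε
    have hev2 := hlimo.eventually_lt_const (show _ < 2 * ε by linarith)
    have hev3 := (Filter.eventually_all_finset S).2 fun z hz => (hρ z hz).1
    filter_upwards [hev1, hev2, hev3, eventually_ge_atTop 1] with N h1 h2 h3 hN
    have hN0 : (0 : ℝ) < N := by exact_mod_cast hN
    have h4 : ‖(N : ℝ)⁻¹ • ∑ m ∈ Finset.range N, f (w m) -
        (N : ℝ)⁻¹ • ∑ m ∈ Finset.range N, step n (fun i => g (i / n)) (w m)‖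
        ≤ 2 * ε + S.card * ε := by
      rw [← smul_sub, ← Finset.sum_sub_distrib, norm_smul, Real.norm_of_nonneg (by positivity)]
      have h5 : ‖∑ m ∈ Finset.range N, (f (w m) - step n (fun i => g (i / n)) (w m))‖
          ≤ ∑ m ∈ Finset.range N, step n o (w m) + S.card * (N * ε) := by
        refine (norm_sum_le _ _).trans ((Finset.sum_le_sum fun m _ => hpt (w m)).trans ?_)
        rw [Finset.sum_add_distrib, Finset.sum_comm (t := S)]
        gcongr
        rw [← nsmul_eq_mul]
        exact Finset.sum_le_card_nsmul _ _ _ h3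
      refine (mul_le_mul_of_nonneg_left h5 (by positivity)).trans ?_
      rw [mul_add]
      refine add_le_add h2.le (le_of_eq ?_)
      field_simp
    rw [norm_sub_rev] at hIG
    have h6 := norm_sub_le_norm_sub_add_norm_sub
      ((N : ℝ)⁻¹ • ∑ m ∈ Finset.range N, f (w m))
      ((N : ℝ)⁻¹ • ∑ m ∈ Finset.range N, step n (fun i => g (i / n)) (w m))
      (∫ y in (0 : ℝ)..1, f y)
    have h7 := norm_sub_le_norm_sub_add_norm_sub
      ((N : ℝ)⁻¹ • ∑ m ∈ Finset.range N, step n (fun i => g (i / n)) (w m)) G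
      (∫ y in (0 : ℝ)..1, f y)
    linarith
  rw [tendsto_iff_norm_sub_tendsto_zero, Metric.tendsto_atTop']
  intro ε hε
  have hpos : (0 : ℝ) < 2 * (4 + 2 * S.card) := by positivity
  obtain ⟨N₀, hN₀⟩ := eventually_atTop.1 (main (ε / (2 * (4 + 2 * S.card))) (by positivity))
  refine ⟨N₀, fun N hN => ?_⟩
  rw [Real.dist_eq, sub_zero, abs_of_nonneg (norm_nonneg _)]
  refine (hN₀ N hN.le).trans_lt ?_
  have : (4 + 2 * (S.card : ℝ)) * (ε / (2 * (4 + 2 * S.card))) = ε / 2 := by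
    field_simp
  linarith

/-- The ⌊2T⌋ whole periods give the integral over one period; the incomplete period and the
fractional part of 2T leave an error O(1/T). -/
theorem hasMean_of_periodic {f : ℝ → ℂ} (hf : Function.Periodic f 1)
    (hfi : ∀ a b, IntervalIntegrable f volume a b) : HasMean f (∫ y in (0 : ℝ)..1, f y) := by
  obtain ⟨I, hI⟩ : ∃ I : ℂ, I = ∫ y in (0 : ℝ)..1, f y := ⟨_, rfl⟩
  obtain ⟨B, hB⟩ : ∃ B : ℝ, B = ∫ y in (0 : ℝ)..1, ‖f y‖ := ⟨_, rfl⟩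
  have hnper : Function.Periodic (fun y => ‖f y‖) 1 := fun y => by
    change ‖f (y + 1)‖ = ‖f y‖
    rw [hf y]
  have hB0 : 0 ≤ B := hB ▸ intervalIntegral.integral_nonneg zero_le_one fun _ _ => norm_nonneg _
  have hbound : ∀ T : ℝ, 0 < T →
      ‖(1 / (2 * T : ℂ)) * (∫ y in (-T)..T, f y) - I‖ ≤ (B + ‖I‖) / (2 * T) := by
    intro T hT
    have hfl := Int.floor_le (2 * T)
    have hfl' := Int.lt_floor_add_one (2 * T)
    have h1 : ∫ y in (-T)..(-T + ⌊2 * T⌋ • (1 : ℝ)), f y = ⌊2 * T⌋ • I := by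
      rw [hf.intervalIntegral_add_zsmul_eq _ _ hfi, hf.intervalIntegral_add_eq (-T) 0, zero_add,
        hI]
    have h2 : ‖∫ y in (-T + ⌊2 * T⌋ • (1 : ℝ))..T, f y‖ ≤ B := by
      have hle : -T + ⌊2 * T⌋ • (1 : ℝ) ≤ T := by
        rw [zsmul_eq_mul, mul_one]
        linarith
      refine (intervalIntegral.norm_integral_le_integral_norm hle).trans ?_
      rw [hB, ← zero_add (1 : ℝ), ← hnper.intervalIntegral_add_eq (-T + ⌊2 * T⌋ • (0 + 1 : ℝ)) 0]
      refine intervalIntegral.integral_mono_interval le_rfl (by simpa using hle) ?_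
        (ae_of_all _ fun _ => norm_nonneg _) (hfi _ _).norm
      rw [zero_add, zsmul_eq_mul, mul_one]
      linarith
    have h3 : (1 / (2 * T : ℂ)) * (∫ y in (-T)..T, f y) - I = ((2 * T : ℝ) : ℂ)⁻¹ *
        ((∫ y in (-T + ⌊2 * T⌋ • (1 : ℝ))..T, f y) - ((Int.fract (2 * T) : ℝ) : ℂ) * I) := by
      have hT' : (T : ℂ) ≠ 0 := by exact_mod_cast hT.ne'
      rw [← intervalIntegral.integral_add_adjacent_intervals
        (hfi (-T) (-T + ⌊2 * T⌋ • (1 : ℝ))) (hfi _ T), h1, Int.fract, zsmul_eq_mul]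
      push_cast
      field_simp
      ring
    rw [h3, norm_mul, norm_inv, Complex.norm_real, Real.norm_of_nonneg (by positivity),
      div_eq_inv_mul]
    gcongr
    refine (norm_sub_le _ _).trans (add_le_add h2 ?_)
    rw [norm_mul, Complex.norm_real, Real.norm_of_nonneg (Int.fract_nonneg _)]
    exact mul_le_of_le_one_left (norm_nonneg _) (Int.fract_lt_one _).le
  rw [HasMean, ← hI, tendsto_iff_norm_sub_tendsto_zero]
  have hlim : Tendsto (fun T : ℝ => (B + ‖I‖) / (2 * T)) atTop (𝓝 0) :=
    tendsto_const_nhds.div_atTop (tendsto_id.const_mul_atTop two_pos)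
  refine squeeze_zero' (Eventually.of_forall fun _ => norm_nonneg _) ?_ hlim
  filter_upwards [eventually_gt_atTop 0] with T hT
  exact hbound T hT

end SobolAverage

theorem mainTheorem3 (α : ℝ) (hα : 1 < |α|) (f : ℝ → ℂ)
    (hf_loc : LocallyIntegrable f volume) (hf_per : Function.Periodic f 1)
    (F : Set ℝ) (hF_fin : F.Finite) (hF_sub : F ⊆ Icc 0 1)
    (hf_riem : ∀ δ : ℝ, 0 < δ →
      SobolAverage.RiemannIntegrableOn f (Icc 0 1 \ (F + Ioo (-δ) δ)) 0 1)
    (hf_var : ∀ z ∈ F, ∃ δ : ℝ, 0 < δ ∧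
      DifferentiableOn ℝ f (Ioo (z - δ) (z + δ) \ {z}) ∧
      ∀ s : ℝ, 0 < s → ∃ η : ℝ, 0 < η ∧
        (∀ᶠ N : ℕ in atTop, SobolAverage.V f z δ s N ≠ ∞) ∧
        (fun N : ℕ => (SobolAverage.V f z δ s N).toReal)
          =o[atTop] (fun N : ℕ => (N : ℝ) ^ (s / 2 - η))) :
    (∀ᵐ x : ℝ ∂volume,
      Tendsto (fun N : ℕ => (1 / (N : ℂ)) * ∑ n ∈ Finset.range N, f (α ^ n * x))
        atTop (𝓝 (∫ y in (0 : ℝ)..1, f y))) ∧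
    SobolAverage.HasMean f (∫ y in (0 : ℝ)..1, f y) := by
  have hfi : ∀ a b, IntervalIntegrable f volume a b := fun a b =>
    (hf_loc.integrableOn_isCompact isCompact_uIcc).intervalIntegrable
  refine ⟨?_, SobolAverage.hasMean_of_periodic hf_per hfi⟩
  -- There are only countably many rational cells, so one null set covers them all.
  have harc : ∀ᵐ x : ℝ, ∀ n : ℕ, ∀ i : ℕ, i < n → Tendsto (fun N : ℕ =>
      (∑ m ∈ Finset.range N,
        SobolAverage.arc ((i : ℝ) / n) (((i : ℝ) + 1) / n) (α ^ m * x)) / N) atTop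
        (𝓝 (1 / (n : ℝ))) := by
    refine ae_all_iff.2 fun n => ae_all_iff.2 fun i => ?_
    by_cases hi : i < n
    · obtain ⟨h1, h2, h3⟩ := SobolAverage.cell_bounds hi
      filter_upwards [SobolAverage.ae_tendsto_arc_average hα h1 h2 h3] with x hx _
      rwa [show ((i : ℝ) + 1) / n - i / n = 1 / n by ring] at hx
    · exact ae_of_all _ fun x h => absurd h hi
  have hnear : ∀ᵐ x : ℝ, ∀ z ∈ hF_fin.toFinset, ∀ ε > 0, ∃ ρ > 0, ∀ᶠ N : ℕ in atTop,
      ∑ m ∈ Finset.range N,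
        {y | |y - z| < ρ}.indicator (fun t => ‖f t‖) (Int.fract (α ^ m * x)) ≤ N * ε := by
    refine (Filter.eventually_all_finset _).2 fun z hz => ?_
    have hzF : z ∈ F := hF_fin.mem_toFinset.1 hz
    obtain ⟨δ, hδ, hdiff, hV⟩ := hf_var z hzF
    obtain ⟨η, hη, hfin, ho⟩ := hV 1 one_pos
    obtain ⟨q, C, hq1, hq2, hC, k₁, hk⟩ :=
      SobolAverage.exists_growth_of_variation hδ hdiff hη hfin ho
    exact SobolAverage.ae_exists_radius hα (hF_sub hzF) hq1 hq2 hC (fun y => norm_nonneg (f y)) hk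
  filter_upwards [harc, hnear] with x hx1 hx2
  have h := SobolAverage.tendsto_average_of_orbit hf_per (hfi 0 1) (S := hF_fin.toFinset)
    (by simpa using hf_riem) (w := fun n => α ^ n * x) hx1 hx2
  refine h.congr fun N => ?_
  rw [Complex.real_smul]
  push_cast
  rw [one_div]
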